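/- Scalars are $\mathbb{K}=\mathbb{R}$ or $\mathbb{C}$. A Banach couple $\vec X=(X_0,X_1)$ consists of two Banach spaces continuously included in a common Hausdorff topological vector space; $X_0+X_1$ carries the norm $\inf\{\|x_0\|_{X_0}+\|x_1\|_{X_1}: x=x_0+x_1\}$ and $X_0\cap X_1$ the norm $\max\{\|x\|_{X_0},\|x\|_{X_1}\}$. A Banach space $A$ is intermediate with respect to $\vec X$ if $X_0\cap X_1\hookrightarrow A\hookrightarrow X_0+X_1$ continuously. Let $X_j^\circ$ be the closure of $X_0\cap X_1$ in $X_j$ and $\vec X^\circ=(X_0^\circ,X_1^\circ)$. For $x\in X_0+X_1$ put $K(s,t,x;\vec X)=\inf\{s\|x_0\|_{X_0}+t\|x_1\|_{X_1}: x=x_0+x_1\}$. An operator $S\colon\vec X\to\vec Y$ is a linear map $X_0+X_1\to Y_0+Y_1$ whose restrictions $X_j\to Y_j$ $(j=0,1)$ are bounded; $\|S\|_{\vec X\to\vec Y}=\max_{j}\|S\|_{X_j\to Y_j}$, and $L(\vec X,\vec Y)$ is the space of these operators. A bilinear operator $T\colon\vec X\times\vec Y\to\vec Z$ is a bounded bilinear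 map $(X_0+X_1)\times(Y_0+Y_1)\to Z_0+Z_1$ whose restrictions $X_j\times Y_j\to Z_j$ $(j=0,1)$ are bounded bilinear maps. A bilinear map is compact if it maps bounded sets to precompact (totally bounded) sets. A couple $\vec A$ has property $(Ap)$ if there are operators $P_n,P_n^+,P_n^-\colon\vec A\to\vec A$ $(n\in\mathbb{N})$, uniformly bounded in $\vec A$, such that $P_n$ maps $A_0+A_1$ boundedly into $A_0\cap A_1$, $I=P_n+P_n^++P_n^-$ on $A_0+A_1$, $P_n^+$ maps $A_0$ to $A_1$ and $P_n^-$ maps $A_1$ to $A_0$ boundedly, and $\|P_n^+\|_{A_0\to A_1}\to0$, $\|P_n^-\|_{A_1\to A_0}\to0$. For $A$ intermediate with respect to $\vec A$ put, for $s,t>0$, $\psi_A(s,t)=\sup\{K(s,t,a;\vec A):\|a\|_A=1\}$ and $\phi_A(s,t)=\sup\{\|a\|_A: a\in A_0\cap A_1,\ \|a\|_{A_0}\le s,\ \|a\|_{A_1}\le t\}$. Let $\Phi_0$ be the set of functions $\varphi\colon(0,\infty)^2\to(0,\infty)$, nondecreasing in each variable, with $\varphi(\lambda s,\lambda t)=\lambda\varphi(s,t)$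 for $\lambda>0$ and $\lim_{s\to0}\varphi(1,s)=\lim_{s\to0}\varphi(s,1)=0$, extended by continuity to $[0,\infty)^2$. For $A,B,C$ intermediate with respect to $\vec X,\vec Y,\vec Z$, write $(A,B;C)\in\mathcal{B}_\varphi(\vec X,\vec Y;\vec Z)$ if every bilinear operator $T\colon\vec X\times\vec Y\to\vec Z$ restricts to a bounded bilinear map $A\times B\to C$ with $\|T\|_{A\times B\to C}\le\varphi(\|T\|_{X_0\times Y_0\to Z_0},\|T\|_{X_1\times Y_1\to Z_1})$. For $A$ intermediate with respect to $\vec A$ and any Banach couple $\vec X$, let $\Gamma$ and $J$ be the closed unit balls of $L(\vec A,\vec X)$ and $L(\vec X,\vec A)$. Then $Orb_A^{\vec A}(\vec X)$ is the space of all $x=\sum_{S\in\Gamma}S(a_S)$ with $\{a_S\}\in\ell_1(\Gamma,A)$, with norm $\inf\sum_{S\in\Gamma}\|a_S\|_A$ over such representations; and $Corb_A^{\vec A}(\vec X)$ is the space of all $x\in X_0+X_1$ with $\{Rx\}_{R\in J}\in\ell_\infty(J,A)$, with norm $\sup_{R\in J}\|Rx\|_A$. (If $A_0\cap A_1=\{0\}$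 the latter may be only a seminorm.) **Theorem.** Let $A,B,C$ be Banach spaces intermediate with respect to Banach couples $\vec A,\vec B,\vec C$, respectively, where $\vec A,\vec B,\vec C$ have property $(Ap)$ and $\psi_A(s,1)\to0$, $\psi_B(s,1)\to0$, $\phi_C(s,1)\to0$ as $s\to0$. Suppose that, for some $\varphi\in\Phi_0$, $(A,B;C)\in\mathcal{B}_\varphi(\vec A,\vec B;\vec C)$ and $(A,B;C)\in\mathcal{B}_\varphi(\vec A^\circ,\vec B^\circ;\vec C)$ (in particular $A$ and $B$ are also intermediate with respect to $\vec A^\circ$ and $\vec B^\circ$). Let $\vec X,\vec Y,\vec Z$ be any Banach couples and let $T\colon\vec X\times\vec Y\to\vec Z$ be a bilinear operator whose restriction $T\colon X_0\times Y_0\to Z_0$ is compact. Then $T$ restricts to a bounded bilinear map $$T\colon Orb_A^{\vec A}(\vec X)\times Orb_B^{\vec B}(\vec Y)\to Corb_C^{\vec C}(\vec Z),$$ and this map is compact. -/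

import Mathlib

open Filter Topology
open scoped ENNReal NNReal

universe u v w v₁ v₂ v₃ v₄ v₅ v₆ w₁ w₂ w₃

noncomputable section

namespace Interp

/-! ## The image of a Banach space under a continuous linear map -/

section ImageSpace

variable {𝕜 : Type u} [RCLike 𝕜] {V : Type v} [NormedAddCommGroup V] [NormedSpace 𝕜 V]
  {W : Type w} [AddCommGroup W] [Module 𝕜 W] [TopologicalSpace W]

/-- The range `π(V) ⊆ W` of a continuous linear map `π : V → W`. It is given below the norm
`‖y‖ = inf {‖v‖ : π v = y}` (see `ImageSpace.norm_eq`). -/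
def ImageSpace (π : V →L[𝕜] W) : Type w := ↥(LinearMap.range (π : V →ₗ[𝕜] W))

namespace ImageSpace

variable (π : V →L[𝕜] W)

instance : AddCommGroup (ImageSpace π) :=
  inferInstanceAs (AddCommGroup ↥(LinearMap.range (π : V →ₗ[𝕜] W)))

instance : Module 𝕜 (ImageSpace π) :=
  inferInstanceAs (Module 𝕜 ↥(LinearMap.range (π : V →ₗ[𝕜] W)))

/-- The inclusion of the range in `W`. -/
def val : ImageSpace π →ₗ[𝕜] W := (LinearMap.range (π : V →ₗ[𝕜] W)).subtype

/-- `π` as a surjection onto its range. -/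
def mk : V →ₗ[𝕜] ImageSpace π := (π : V →ₗ[𝕜] W).rangeRestrict

@[simp] theorem val_mk (x : V) : val π (mk π x) = π x := rfl

theorem val_injective : Function.Injective (val π) := Subtype.val_injective

theorem mk_surjective : Function.Surjective (mk π) :=
  LinearMap.surjective_rangeRestrict _

/-- The range is algebraically `V / ker π`. -/
def equivQuot : ImageSpace π ≃ₗ[𝕜] (V ⧸ LinearMap.ker (π : V →ₗ[𝕜] W)) :=
  (π : V →ₗ[𝕜] W).quotKerEquivRange.symm

theorem equivQuot_mk (x : V) : equivQuot π (mk π x) = Submodule.Quotient.mk x := by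
  exact (LinearEquiv.symm_apply_eq ((π : V →ₗ[𝕜] W).quotKerEquivRange)).2 rfl

variable [T2Space W]

instance isClosed_ker : IsClosed (LinearMap.ker (π : V →ₗ[𝕜] W) : Set V) :=
  ContinuousLinearMap.isClosed_ker π

instance : NormedAddCommGroup (ImageSpace π) :=
  NormedAddCommGroup.induced (ImageSpace π) (V ⧸ LinearMap.ker (π : V →ₗ[𝕜] W)) (equivQuot π)
    (equivQuot π).injective

instance : NormedSpace 𝕜 (ImageSpace π) :=
  NormedSpace.induced 𝕜 (ImageSpace π) (V ⧸ LinearMap.ker (π : V →ₗ[𝕜] W)) (equivQuot π)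

theorem norm_def (y : ImageSpace π) : ‖y‖ = ‖equivQuot π y‖ := rfl

theorem norm_mk_le (x : V) : ‖mk π x‖ ≤ ‖x‖ := by
  rw [norm_def, equivQuot_mk]
  exact Submodule.Quotient.norm_mk_le _ x

theorem exists_lt (y : ImageSpace π) {ε : ℝ} (hε : 0 < ε) :
    ∃ x : V, mk π x = y ∧ ‖x‖ < ‖y‖ + ε := by
  obtain ⟨m, hm, h⟩ := Submodule.Quotient.norm_mk_lt (equivQuot π y) hε
  exact ⟨m, (equivQuot π).injective (by rw [equivQuot_mk, hm]), h⟩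

theorem norm_eq (y : ImageSpace π) : ‖y‖ = sInf {r : ℝ | ∃ x : V, π x = val π y ∧ r = ‖x‖} := by
  have key : ∀ x : V, π x = val π y → ‖y‖ ≤ ‖x‖ := fun x hx => by
    have : mk π x = y := val_injective π hx
    rw [← this]; exact norm_mk_le π x
  apply le_antisymm
  · apply le_csInf
    · obtain ⟨x, rfl⟩ := mk_surjective π y
      exact ⟨‖x‖, x, rfl, rfl⟩
    · rintro r ⟨x, hx, rfl⟩
      exact key x hx
  · refine le_of_forall_pos_lt_add fun ε hε => ?_
    obtain ⟨x, rfl, hx⟩ := exists_lt π y hε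
    refine lt_of_le_of_lt (csInf_le ⟨0, ?_⟩ ⟨x, rfl, rfl⟩) hx
    rintro r ⟨z, -, rfl⟩
    exact norm_nonneg z

instance [CompleteSpace V] : CompleteSpace (ImageSpace π) :=
  ((IsUniformInducing.mk rfl : IsUniformInducing (equivQuot π)).completeSpace_congr
    (equivQuot π).surjective).2 inferInstance

end ImageSpace

end ImageSpace

/-! ## Banach couples -/

/-- A Banach couple: Banach spaces `X0`, `X1` continuously and injectively included in a common
Hausdorff topological vector space `E`. -/
structure BanachCouple (𝕜 : Type u) [RCLike 𝕜] where
  E : Type v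
  [addCommGroupE : AddCommGroup E]
  [moduleE : Module 𝕜 E]
  [topE : TopologicalSpace E]
  [topGroupE : IsTopologicalAddGroup E]
  [contSMulE : ContinuousSMul 𝕜 E]
  [t2E : T2Space E]
  X0 : Type v
  [normed0 : NormedAddCommGroup X0]
  [space0 : NormedSpace 𝕜 X0]
  [complete0 : CompleteSpace X0]
  X1 : Type v
  [normed1 : NormedAddCommGroup X1]
  [space1 : NormedSpace 𝕜 X1]
  [complete1 : CompleteSpace X1]
  i0 : X0 →L[𝕜] E
  i1 : X1 →L[𝕜] E
  inj0 : Function.Injective i0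
  inj1 : Function.Injective i1

attribute [instance] BanachCouple.addCommGroupE BanachCouple.moduleE BanachCouple.topE
  BanachCouple.topGroupE BanachCouple.contSMulE BanachCouple.t2E
  BanachCouple.normed0 BanachCouple.space0 BanachCouple.complete0
  BanachCouple.normed1 BanachCouple.space1 BanachCouple.complete1

namespace BanachCouple

variable {𝕜 : Type u} [RCLike 𝕜] (X : BanachCouple.{u, v} 𝕜)

/-- `(x0, x1) ↦ x0 + x1` from the `ℓ₁`-product of `X0` and `X1` to `E`. -/
def addMap : WithLp 1 (X.X0 × X.X1) →L[𝕜] X.E :=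
  (X.i0.comp (ContinuousLinearMap.fst 𝕜 X.X0 X.X1) +
    X.i1.comp (ContinuousLinearMap.snd 𝕜 X.X0 X.X1)).comp
      (WithLp.prodContinuousLinearEquiv 1 𝕜 X.X0 X.X1 : WithLp 1 (X.X0 × X.X1) →L[𝕜] X.X0 × X.X1)

theorem addMap_apply (p : WithLp 1 (X.X0 × X.X1)) : X.addMap p = X.i0 p.fst + X.i1 p.snd := rfl

/-- The sum `X0 + X1 ⊆ E`, with the norm `inf {‖x0‖ + ‖x1‖ : x = x0 + x1}`. -/
abbrev Sum : Type v := ImageSpace X.addMap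

/-- The inclusion `X0 + X1 ⊆ E`. -/
def toE : X.Sum →ₗ[𝕜] X.E := ImageSpace.val X.addMap

/-- The inclusion `X0 ⊆ X0 + X1`. -/
def in0 : X.X0 →L[𝕜] X.Sum :=
  LinearMap.mkContinuous
    ((ImageSpace.mk X.addMap).comp
      ((WithLp.linearEquiv 1 𝕜 (X.X0 × X.X1)).symm.toLinearMap.comp
        (LinearMap.inl 𝕜 X.X0 X.X1))) 1 (fun x => by
    refine (ImageSpace.norm_mk_le _ _).trans ?_
    rw [WithLp.prod_norm_eq_of_L1]
    simp)

/-- The inclusion `X1 ⊆ X0 + X1`. -/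
def in1 : X.X1 →L[𝕜] X.Sum :=
  LinearMap.mkContinuous
    ((ImageSpace.mk X.addMap).comp
      ((WithLp.linearEquiv 1 𝕜 (X.X0 × X.X1)).symm.toLinearMap.comp
        (LinearMap.inr 𝕜 X.X0 X.X1))) 1 (fun x => by
    refine (ImageSpace.norm_mk_le _ _).trans ?_
    rw [WithLp.prod_norm_eq_of_L1]
    simp)

theorem toE_in0 (x : X.X0) : X.toE (X.in0 x) = X.i0 x := by
  change X.i0 x + X.i1 0 = X.i0 x
  simp

theorem toE_in1 (x : X.X1) : X.toE (X.in1 x) = X.i1 x := by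
  change X.i0 0 + X.i1 x = X.i1 x
  simp

theorem mk_eq (p : WithLp 1 (X.X0 × X.X1)) :
    ImageSpace.mk X.addMap p = X.in0 p.fst + X.in1 p.snd := by
  apply ImageSpace.val_injective
  change X.addMap p = X.toE (X.in0 p.fst + X.in1 p.snd)
  rw [map_add, toE_in0, toE_in1, addMap_apply]

/-- The intersection `X0 ∩ X1`, as the set of pairs `(x0, x1)` whose entries are the same element
of `E`, with the norm `max ‖x‖_{X0} ‖x‖_{X1}` of the product `X0 × X1`. -/
def interSubmodule : Submodule 𝕜 (X.X0 × X.X1) where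
  carrier := {p | X.i0 p.1 = X.i1 p.2}
  add_mem' := fun {a b} ha hb => by
    simp only [Set.mem_ofPred_eq, Prod.fst_add, Prod.snd_add, map_add] at *
    rw [ha, hb]
  zero_mem' := by simp
  smul_mem' := fun c a ha => by
    simp only [Set.mem_ofPred_eq, Prod.smul_fst, Prod.smul_snd, map_smul] at *
    rw [ha]

/-- The Banach space `X0 ∩ X1`. -/
abbrev Inter : Type v := ↥X.interSubmodule

/-- The inclusion `X0 ∩ X1 ⊆ X0 + X1`. -/
def interToSum : X.Inter →L[𝕜] X.Sum :=
  X.in0.comp ((ContinuousLinearMap.fst 𝕜 X.X0 X.X1).comp X.interSubmodule.subtypeL)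

/-- The `K`-functional `K(s, t, x) = inf {s‖x0‖ + t‖x1‖ : x = x0 + x1}`. -/
def K (s t : ℝ≥0) (x : X.Sum) : ℝ≥0∞ :=
  ⨅ (x0 : X.X0) (x1 : X.X1) (_ : x = X.in0 x0 + X.in1 x1), s * ‖x0‖ₑ + t * ‖x1‖ₑ

/-- `X0°`: the closure of `X0 ∩ X1` in `X0`. -/
def core0 : Submodule 𝕜 X.X0 :=
  (Submodule.comap (X.i0 : X.X0 →ₗ[𝕜] X.E)
    (LinearMap.range (X.i1 : X.X1 →ₗ[𝕜] X.E))).topologicalClosure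

/-- `X1°`: the closure of `X0 ∩ X1` in `X1`. -/
def core1 : Submodule 𝕜 X.X1 :=
  (Submodule.comap (X.i1 : X.X1 →ₗ[𝕜] X.E)
    (LinearMap.range (X.i0 : X.X0 →ₗ[𝕜] X.E))).topologicalClosure

instance : CompleteSpace X.core0 :=
  (Submodule.isClosed_topologicalClosure _).completeSpace_coe

instance : CompleteSpace X.core1 :=
  (Submodule.isClosed_topologicalClosure _).completeSpace_coe

/-- The couple `(X0°, X1°)`. -/
def reg : BanachCouple.{u, v} 𝕜 where
  E := X.E
  X0 := X.core0
  X1 := X.core1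
  i0 := X.i0.comp X.core0.subtypeL
  i1 := X.i1.comp X.core1.subtypeL
  inj0 := X.inj0.comp Subtype.val_injective
  inj1 := X.inj1.comp Subtype.val_injective

end BanachCouple

/-! ## Intermediate spaces and operators between couples -/

/-- The structure of an intermediate space on the Banach space `A`:
`X0 ∩ X1 ↪ A ↪ X0 + X1` continuously, the composition being the inclusion. -/
structure Intermediate {𝕜 : Type u} [RCLike 𝕜] (X : BanachCouple.{u, v} 𝕜)
    (A : Type w) [NormedAddCommGroup A] [NormedSpace 𝕜 A] where
  incl : A →L[𝕜] X.Sum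
  inj : Function.Injective incl
  interIncl : X.Inter →L[𝕜] A
  comp_eq : ∀ x : X.Inter, incl (interIncl x) = X.interToSum x

namespace Intermediate

variable {𝕜 : Type u} [RCLike 𝕜] {X : BanachCouple.{u, v} 𝕜}
  {A : Type w} [NormedAddCommGroup A] [NormedSpace 𝕜 A] (j : Intermediate X A)

/-- `φ_A(s, t) = sup {‖x‖_A : x ∈ X0 ∩ X1, ‖x‖_{X0} ≤ s, ‖x‖_{X1} ≤ t}`. -/
def phi (s t : ℝ≥0) : ℝ≥0∞ :=
  ⨆ (x : X.Inter) (_ : ‖x.1.1‖₊ ≤ s) (_ : ‖x.1.2‖₊ ≤ t), ‖j.interIncl x‖ₑ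

/-- `ψ_A(s, t) = sup {K(s, t, a) : ‖a‖_A = 1}`. -/
def psi (s t : ℝ≥0) : ℝ≥0∞ :=
  ⨆ (a : A) (_ : ‖a‖ = 1), X.K s t (j.incl a)

end Intermediate

/-- An operator `X⃗ → Y⃗`: a linear operator `X0 + X1 → Y0 + Y1` whose restrictions
`X0 → Y0` and `X1 → Y1` are bounded. -/
structure CoupleHom {𝕜 : Type u} [RCLike 𝕜] (X : BanachCouple.{u, v} 𝕜)
    (Y : BanachCouple.{u, w} 𝕜) where
  map : X.Sum →L[𝕜] Y.Sum
  map0 : X.X0 →L[𝕜] Y.X0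
  map1 : X.X1 →L[𝕜] Y.X1
  comm0 : ∀ x, map (X.in0 x) = Y.in0 (map0 x)
  comm1 : ∀ x, map (X.in1 x) = Y.in1 (map1 x)

/-- The norm `max_j ‖T : X_j → Y_j‖` of `T : X⃗ → Y⃗`. -/
def CoupleHom.opNorm {𝕜 : Type u} [RCLike 𝕜] {X : BanachCouple.{u, v} 𝕜}
    {Y : BanachCouple.{u, w} 𝕜} (T : CoupleHom X Y) : ℝ := max ‖T.map0‖ ‖T.map1‖

theorem CoupleHom.norm_map_le {𝕜 : Type u} [RCLike 𝕜] {X : BanachCouple.{u, v} 𝕜}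
    {Y : BanachCouple.{u, w} 𝕜} (T : CoupleHom X Y) (h : T.opNorm ≤ 1) (x : X.Sum) :
    ‖T.map x‖ ≤ ‖x‖ := by
  refine le_of_forall_pos_lt_add fun ε hε => ?_
  obtain ⟨p, rfl, hp⟩ := ImageSpace.exists_lt X.addMap x hε
  refine lt_of_le_of_lt ?_ hp
  have h0 : ‖T.map0 p.fst‖ ≤ ‖p.fst‖ := by
    simpa using T.map0.le_of_opNorm_le ((le_max_left _ _).trans h) p.fst
  have h1 : ‖T.map1 p.snd‖ ≤ ‖p.snd‖ := by
    simpa using T.map1.le_of_opNorm_le ((le_max_right _ _).trans h) p.snd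
  have e : T.map (ImageSpace.mk X.addMap p) =
      ImageSpace.mk Y.addMap (WithLp.toLp 1 (T.map0 p.fst, T.map1 p.snd)) := by
    rw [BanachCouple.mk_eq, BanachCouple.mk_eq, map_add, T.comm0, T.comm1]; rfl
  rw [e]
  refine (ImageSpace.norm_mk_le _ _).trans ?_
  rw [WithLp.prod_norm_eq_of_L1, WithLp.prod_norm_eq_of_L1]
  exact add_le_add h0 h1

/-- The closed unit ball of `L(X⃗, Y⃗)`. -/
def UnitBall {𝕜 : Type u} [RCLike 𝕜] (X : BanachCouple.{u, v} 𝕜)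
    (Y : BanachCouple.{u, w} 𝕜) : Type (max v w) :=
  {T : CoupleHom X Y // T.opNorm ≤ 1}

/-- The approximation property `(Ap)` of a Banach couple. -/
def ApproxProperty {𝕜 : Type u} [RCLike 𝕜] (X : BanachCouple.{u, v} 𝕜) : Prop :=
  ∃ (P : ℕ → CoupleHom X X) (Pp : ℕ → CoupleHom X X) (Pm : ℕ → CoupleHom X X)
    (Pint : ℕ → X.Sum →L[𝕜] X.Inter)
    (Pp01 : ℕ → X.X0 →L[𝕜] X.X1) (Pm10 : ℕ → X.X1 →L[𝕜] X.X0),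
    -- `P n` maps `X0 + X1` to `X0 ∩ X1`
    (∀ n x, (P n).map x = X.interToSum (Pint n x)) ∧
    -- uniform boundedness
    (∃ C : ℝ, ∀ n, (P n).opNorm ≤ C ∧ (Pp n).opNorm ≤ C ∧ (Pm n).opNorm ≤ C) ∧
    -- decomposition of the identity
    (∀ n x, x = (P n).map x + (Pp n).map x + (Pm n).map x) ∧
    -- `Pp n : X0 → X1` and `Pm n : X1 → X0`, with norms tending to zero
    (∀ n x, (Pp n).map (X.in0 x) = X.in1 (Pp01 n x)) ∧
    (∀ n x, (Pm n).map (X.in1 x) = X.in0 (Pm10 n x)) ∧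
    Tendsto (fun n => ‖Pp01 n‖) atTop (𝓝 0) ∧
    Tendsto (fun n => ‖Pm10 n‖) atTop (𝓝 0)

/-! ## Bilinear operators -/

section Bilinear

variable {𝕜 : Type u} [RCLike 𝕜]

/-- A bilinear operator `X⃗ × Y⃗ → Z⃗`: a bounded bilinear operator
`(X0 + X1) × (Y0 + Y1) → Z0 + Z1` whose restrictions to `X0 × Y0` and `X1 × Y1` are bounded bilinear
operators `X0 × Y0 → Z0` and `X1 × Y1 → Z1`. -/
structure BilinearHom (X : BanachCouple.{u, v₁} 𝕜) (Y : BanachCouple.{u, v₂} 𝕜)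
    (Z : BanachCouple.{u, v₃} 𝕜) where
  map : X.Sum →L[𝕜] Y.Sum →L[𝕜] Z.Sum
  map0 : X.X0 →L[𝕜] Y.X0 →L[𝕜] Z.X0
  map1 : X.X1 →L[𝕜] Y.X1 →L[𝕜] Z.X1
  comm0 : ∀ x y, map (X.in0 x) (Y.in0 y) = Z.in0 (map0 x y)
  comm1 : ∀ x y, map (X.in1 x) (Y.in1 y) = Z.in1 (map1 x y)

/-- A bilinear map is compact if it maps bounded sets of `V × W` to precompact sets. -/
def IsCompactBilinear {V : Type v₁} {W : Type v₂} {F : Type v₃}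
    [SeminormedAddCommGroup V] [NormedSpace 𝕜 V] [SeminormedAddCommGroup W] [NormedSpace 𝕜 W]
    [SeminormedAddCommGroup F] [NormedSpace 𝕜 F] (S : V →L[𝕜] W →L[𝕜] F) : Prop :=
  ∀ s : Set (V × W), Bornology.IsBounded s → TotallyBounded ((fun p => S p.1 p.2) '' s)

/-- The class `Φ`: functions `φ > 0` on `(0, ∞) × (0, ∞)`, nondecreasing in each variable and
positively homogeneous, identified with their continuous extensions to `[0, ∞) × [0, ∞)`. -/
structure IsPhi (φ : ℝ≥0 → ℝ≥0 → ℝ≥0) : Prop where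
  pos : ∀ s t, 0 < s → 0 < t → 0 < φ s t
  mono : ∀ s s' t t', s ≤ s' → t ≤ t' → φ s t ≤ φ s' t'
  homog : ∀ r s t, 0 < r → φ (r * s) (r * t) = r * φ s t
  cont : Continuous fun p : ℝ≥0 × ℝ≥0 => φ p.1 p.2

/-- The class `Φ₀`: those `φ ∈ Φ` with `φ(1, s) → 0` and `φ(s, 1) → 0` as `s → 0`. -/
structure IsPhiZero (φ : ℝ≥0 → ℝ≥0 → ℝ≥0) : Prop extends IsPhi φ where
  lim_right : Tendsto (fun s => φ 1 s) (𝓝[>] 0) (𝓝 0)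
  lim_left : Tendsto (fun s => φ s 1) (𝓝[>] 0) (𝓝 0)

/-- `(A, B; C) ∈ 𝓑_φ(X⃗, Y⃗; Z⃗)`: every bilinear operator `T : X⃗ × Y⃗ → Z⃗` restricts to a
bounded bilinear operator `A × B → C` with
`‖T‖_{A × B → C} ≤ φ(‖T‖_{X0 × Y0 → Z0}, ‖T‖_{X1 × Y1 → Z1})`. -/
def IsBilinearInterpolation (φ : ℝ≥0 → ℝ≥0 → ℝ≥0)
    {X : BanachCouple.{u, v₁} 𝕜} {Y : BanachCouple.{u, v₂} 𝕜} {Z : BanachCouple.{u, v₃} 𝕜}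
    {A : Type w₁} [NormedAddCommGroup A] [NormedSpace 𝕜 A]
    {B : Type w₂} [NormedAddCommGroup B] [NormedSpace 𝕜 B]
    {C : Type w₃} [NormedAddCommGroup C] [NormedSpace 𝕜 C]
    (jA : Intermediate X A) (jB : Intermediate Y B) (jC : Intermediate Z C) : Prop :=
  ∀ T : BilinearHom X Y Z, ∃ S : A →L[𝕜] B →L[𝕜] C,
    (∀ a b, jC.incl (S a b) = T.map (jA.incl a) (jB.incl b)) ∧
    ‖S‖₊ ≤ φ ‖T.map0‖₊ ‖T.map1‖₊

end Bilinear

/-! ## Aronszajn–Gagliardo functors -/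

theorem lp_one_summable_norm {Γ : Type v} {A : Type w} [NormedAddCommGroup A]
    (a : lp (fun _ : Γ => A) 1) : Summable fun S => ‖a S‖ := by
  simpa using (lp.memℓp a).summable (by simp)

section Orb

variable {𝕜 : Type u} [RCLike 𝕜] {A : Type w} [NormedAddCommGroup A] [NormedSpace 𝕜 A]
  {Ac : BanachCouple.{u, v₁} 𝕜} (j : Intermediate Ac A) (X : BanachCouple.{u, v₂} 𝕜)

theorem orb_norm_le (a : lp (fun _ : UnitBall Ac X => A) 1) (S : UnitBall Ac X) :
    ‖S.1.map (j.incl (a S))‖ ≤ ‖j.incl‖ * ‖a S‖ :=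
  (S.1.norm_map_le S.2 _).trans (j.incl.le_opNorm _)

theorem orb_summable (a : lp (fun _ : UnitBall Ac X => A) 1) :
    Summable fun S : UnitBall Ac X => S.1.map (j.incl (a S)) :=
  Summable.of_norm_bounded ((lp_one_summable_norm a).mul_left ‖j.incl‖) (orb_norm_le j X a)

/-- `π {a_S} = ∑_S S(a_S)`, from `ℓ₁(Γ, A)` to `X0 + X1`, where `Γ` is the unit ball
of `L(A⃗, X⃗)`. -/
def orbMap : lp (fun _ : UnitBall Ac X => A) 1 →L[𝕜] X.Sum :=
  LinearMap.mkContinuous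
    { toFun := fun a => ∑' S : UnitBall Ac X, S.1.map (j.incl (a S))
      map_add' := fun a b => by
        rw [← (orb_summable j X a).tsum_add (orb_summable j X b)]
        simp
      map_smul' := fun c a => by
        simp [(orb_summable j X a).tsum_const_smul] }
    ‖j.incl‖ (fun a => by
      have h := (lp_one_summable_norm a).mul_left ‖j.incl‖
      refine (tsum_of_norm_bounded h.hasSum (orb_norm_le j X a)).trans ?_
      rw [tsum_mul_left, lp.norm_eq_tsum_rpow (by simp)]
      simp)

/-- The orbit space `Orb_A^{A⃗}(X⃗) = π(ℓ₁(Γ, A)) ⊆ X0 + X1`, with the norm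
`‖x‖ = inf {∑_S ‖a_S‖ : x = π {a_S}}`. -/
abbrev Orb : Type v₂ := ImageSpace (orbMap j X)

/-- The inclusion `Orb_A^{A⃗}(X⃗) ⊆ X0 + X1`. -/
def Orb.toSum : Orb j X →ₗ[𝕜] X.Sum := ImageSpace.val (orbMap j X)

end Orb

section Corb

variable {𝕜 : Type u} [RCLike 𝕜] {A : Type w} [NormedAddCommGroup A] [NormedSpace 𝕜 A]
  {Ac : BanachCouple.{u, v₁} 𝕜} (j : Intermediate Ac A) (X : BanachCouple.{u, v₂} 𝕜)

/-- The coorbit space as a subspace of `X0 + X1`: those `x` for which `{T x}`, indexed by the unit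
ball `J` of `L(X⃗, A⃗)`, belongs to `ℓ_∞(J, A)`. -/
def corbSubmodule : Submodule 𝕜 X.Sum where
  carrier := {x | ∃ f : lp (fun _ : UnitBall X Ac => A) ∞, ∀ T, j.incl (f T) = T.1.map x}
  add_mem' := by
    rintro x y ⟨f, hf⟩ ⟨g, hg⟩
    exact ⟨f + g, fun T => by simp [hf, hg]⟩
  zero_mem' := ⟨0, fun T => by simp⟩
  smul_mem' := by
    rintro c x ⟨f, hf⟩
    exact ⟨c • f, fun T => by simp [hf]⟩

/-- The coorbit space `Corb_A^{A⃗}(X⃗)`, with the norm `‖{T x}‖_{ℓ_∞(J, A)}` given below. -/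
def Corb : Type v₂ := ↥(corbSubmodule j X)

namespace Corb

instance : AddCommGroup (Corb j X) := inferInstanceAs (AddCommGroup ↥(corbSubmodule j X))

instance : Module 𝕜 (Corb j X) := inferInstanceAs (Module 𝕜 ↥(corbSubmodule j X))

/-- The inclusion `Corb_A^{A⃗}(X⃗) ⊆ X0 + X1`. -/
def toSum : Corb j X →ₗ[𝕜] X.Sum := (corbSubmodule j X).subtype

/-- The family `{T x}` in `ℓ_∞(J, A)`, for `x` in the coorbit space. -/
def family (x : Corb j X) : lp (fun _ : UnitBall X Ac => A) ∞ := x.2.choose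

theorem incl_family (x : Corb j X) (T : UnitBall X Ac) :
    j.incl (family j X x T) = T.1.map (toSum j X x) := x.2.choose_spec T

/-- The map `x ↦ {T x}` from the coorbit space to `ℓ_∞(J, A)`. -/
def familyMap : Corb j X →ₗ[𝕜] lp (fun _ : UnitBall X Ac => A) ∞ where
  toFun := family j X
  map_add' := fun x y => by
    ext T
    apply j.inj
    simp [incl_family]
  map_smul' := fun c x => by
    ext T
    apply j.inj
    simp [incl_family]

/-- `‖x‖ = ‖{T x}‖_{ℓ_∞(J, A)}`. This is a norm as soon as `A0 ∩ A1 ≠ 0`. -/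
instance : SeminormedAddCommGroup (Corb j X) :=
  SeminormedAddCommGroup.induced (Corb j X) (lp (fun _ : UnitBall X Ac => A) ∞) (familyMap j X)

instance : NormedSpace 𝕜 (Corb j X) :=
  NormedSpace.induced 𝕜 (Corb j X) (lp (fun _ : UnitBall X Ac => A) ∞) (familyMap j X)

theorem norm_eq (x : Corb j X) : ‖x‖ = ⨆ T : UnitBall X Ac, ‖family j X x T‖ := rfl

end Corb

end Corb

end Interp

end

open Interp

/-!
# Compactness of bilinear operators from orbit spaces to coorbit spaces

Everything happens on the level of the operators `Q ∘ T ∘ (S, R) : A⃗ × B⃗ → C⃗`, where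
`S : A⃗ → X⃗`, `R : B⃗ → Y⃗` and `Q : Z⃗ → C⃗` run over contractions: an estimate of these in the norm of
bilinear maps `A × B → C` that is uniform in `S`, `R`, `Q` passes to the orbit and coorbit spaces,
by absolutely convergent double series (`Intermediate.exists_tsum`). Boundedness of `T` on the orbit
spaces is the estimate given by interpolation.

For compactness, put `V = I - P_n^+` on `A⃗`, `W = I - P_n^+` on `B⃗` and `U = I - P_k^-` on `C⃗`. Here
`V = P_n + P_n^-` maps all of `A0 + A1` into `A0`, likewise `W`, and `U = P_k + P_k^+` maps `C0`
into `C0 ∩ C1` (`ApproxProperty.exists_plus`, `ApproxProperty.exists_minus`). Hence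
`U ∘ Q ∘ T ∘ (S ∘ V, R ∘ W)` factors `A × B → A0 × B0 → X0 × Y0 → Z0 → C0 → C0 ∩ C1 → C`, and
inherits the compactness of `T : X0 × Y0 → Z0`. The error is the sum of
* `Q T(S P_n^+ a, R b)` and `Q T(S V a, R P_n^+ b)`, small on `A0 × B0`: the operator `P_n^+` is small
  from `A0` to `A0 + A1`, so that the values of `T` are small in `Z0 + Z1`, and on a totally bounded
  subset of `Z0` this forces smallness in `Z0` (`BilinearHom.exists_norm_map0_le`);
* `P_k^- Q T(S V a, R W b)`, small on `A0° × B0°`: there `T` takes values in a totally bounded subset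
  of `Z0°`, and `P_k^-` is small on each element of `C0 ∩ C1` (`eventually_norm_map0_le`).

On `A1 × B1` the error is merely bounded, by a bound `M` that does not depend on `n`, `k`. As
`φ(δ, M) → 0` for `δ → 0`, interpolation between `A⃗°`, `B⃗°` and `C⃗` makes the error small on
`A × B` (`exists_approximation`). So `T` is, in operator norm, a limit of compact bilinear maps.
-/

namespace Interp

/-! ### Totally bounded sets and double series -/

/-- A set is totally bounded if, up to any `ε`, the distance of its points is controlled by the
distance of points of some totally bounded set to which they are related. -/
theorem totallyBounded_of_approx {α : Type*} {β : Type*} [PseudoMetricSpace α]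
    [PseudoMetricSpace β] {E : Set α}
    (H : ∀ ε > (0 : ℝ), ∃ (K : Set β) (r : α → β → Prop) (δ : ℝ), TotallyBounded K ∧ 0 < δ ∧
      (∀ e ∈ E, ∃ z ∈ K, r e z) ∧
      ∀ e e' z z', r e z → r e' z' → dist z z' < δ → dist e e' < ε) :
    TotallyBounded E := by
  rw [Metric.totallyBounded_iff]
  intro ε hε
  obtain ⟨K, r, δ, hK, hδ, hr, hd⟩ := H ε hε
  obtain ⟨t, ht, hKt⟩ := Metric.totallyBounded_iff.1 hK (δ / 2) (half_pos hδ)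
  rcases E.eq_empty_or_nonempty with rfl | ⟨e₀, -⟩
  · exact ⟨∅, Set.finite_empty, by simp⟩
  classical
  let c : β → α := fun z =>
    if h : ∃ e, ∃ z', r e z' ∧ dist z' z < δ / 2 then h.choose else e₀
  refine ⟨c '' t, ht.image c, fun e he => ?_⟩
  obtain ⟨z, hz, hez⟩ := hr e he
  obtain ⟨y, hy, hzy⟩ := Set.mem_iUnion₂.1 (hKt hz)
  have hex : ∃ e, ∃ z', r e z' ∧ dist z' y < δ / 2 := ⟨e, z, hez, hzy⟩
  refine Set.mem_iUnion₂.2 ⟨c y, ⟨y, hy, rfl⟩, ?_⟩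
  have hc : c y = hex.choose := dif_pos hex
  obtain ⟨z', hz', hd'⟩ := hex.choose_spec
  rw [Metric.mem_ball, hc]
  refine hd _ _ _ _ hez hz' ?_
  have hzy' : dist z y < δ / 2 := hzy
  linarith [dist_triangle_right z z' y]

/-- On a totally bounded set of a Banach space, the topology induced by an injective bounded map is
not weaker at `0` than that of the norm. -/
theorem exists_norm_le_of_totallyBounded {𝕜 : Type*} [RCLike 𝕜] {V W : Type*}
    [NormedAddCommGroup V] [NormedSpace 𝕜 V] [CompleteSpace V]
    [NormedAddCommGroup W] [NormedSpace 𝕜 W] (i : V →L[𝕜] W) (hi : Function.Injective i)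
    {K : Set V} (hK : TotallyBounded K) {η : ℝ} (hη : 0 < η) :
    ∃ δ > 0, ∀ z ∈ K, ‖i z‖ ≤ δ → ‖z‖ ≤ η := by
  have hc : IsCompact (closure K ∩ {z | η ≤ ‖z‖}) :=
    (TotallyBounded.isCompact_of_isClosed hK.closure isClosed_closure).inter_right
      (isClosed_le continuous_const continuous_norm)
  rcases (closure K ∩ {z | η ≤ ‖z‖}).eq_empty_or_nonempty with he | hne
  · refine ⟨1, one_pos, fun z hz _ => ?_⟩
    by_contra! h
    have : z ∈ closure K ∩ {z | η ≤ ‖z‖} := ⟨subset_closure hz, h.le⟩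
    rw [he] at this
    exact this
  · obtain ⟨z₀, hz₀, hmin⟩ := hc.exists_isMinOn hne (f := fun z => ‖i z‖)
      (by fun_prop)
    have hpos : 0 < ‖i z₀‖ := by
      rw [norm_pos_iff]
      intro h
      have h0 : z₀ = 0 := hi (by rw [h, map_zero])
      have := hz₀.2
      rw [h0] at this
      simp only [Set.mem_ofPred_eq, norm_zero] at this
      linarith
    refine ⟨‖i z₀‖ / 2, half_pos hpos, fun z hz hle => ?_⟩
    by_contra! h
    have h2 : ‖i z₀‖ ≤ ‖i z‖ := hmin (show z ∈ closure K ∩ {z | η ≤ ‖z‖} from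
      ⟨subset_closure hz, h.le⟩)
    linarith

/-- By homogeneity, a bound of a bilinear map on unit balls is a bound of its norm. -/
theorem bilinear_bound_of_unit {𝕜 : Type*} [RCLike 𝕜] {E F G : Type*}
    [NormedAddCommGroup E] [NormedSpace 𝕜 E] [NormedAddCommGroup F] [NormedSpace 𝕜 F]
    [NormedAddCommGroup G] [NormedSpace 𝕜 G] (B : E →L[𝕜] F →L[𝕜] G)
    (p : Submodule 𝕜 E) (q : Submodule 𝕜 F) {δ : ℝ}
    (h : ∀ a ∈ p, ∀ b ∈ q, ‖a‖ ≤ 1 → ‖b‖ ≤ 1 → ‖B a b‖ ≤ δ) :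
    ∀ a ∈ p, ∀ b ∈ q, ‖B a b‖ ≤ δ * ‖a‖ * ‖b‖ := by
  intro a ha b hb
  rcases eq_or_ne a 0 with rfl | ha0
  · simp
  rcases eq_or_ne b 0 with rfl | hb0
  · simp
  have hna := norm_pos_iff.2 ha0
  have hnb := norm_pos_iff.2 hb0
  have key := h (((‖a‖⁻¹ : ℝ) : 𝕜) • a) (p.smul_mem _ ha) (((‖b‖⁻¹ : ℝ) : 𝕜) • b)
    (q.smul_mem _ hb)
    (by rw [norm_smul, RCLike.norm_ofReal, abs_of_pos (inv_pos.2 hna), inv_mul_cancel₀ hna.ne'])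
    (by rw [norm_smul, RCLike.norm_ofReal, abs_of_pos (inv_pos.2 hnb), inv_mul_cancel₀ hnb.ne'])
  rw [map_smul, map_smul, smul_apply, norm_smul, norm_smul,
    RCLike.norm_ofReal, RCLike.norm_ofReal, abs_of_pos (inv_pos.2 hna),
    abs_of_pos (inv_pos.2 hnb)] at key
  calc ‖B a b‖ = (‖b‖⁻¹ * (‖a‖⁻¹ * ‖B a b‖)) * ‖a‖ * ‖b‖ := by field_simp
    _ ≤ δ * ‖a‖ * ‖b‖ := by gcongr

theorem hasSum_bilinear {𝕜 : Type*} [RCLike 𝕜] {E F G ι κ : Type*}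
    [NormedAddCommGroup E] [NormedSpace 𝕜 E] [NormedAddCommGroup F] [NormedSpace 𝕜 F]
    [NormedAddCommGroup G] [NormedSpace 𝕜 G]
    [CompleteSpace E] [CompleteSpace F] [CompleteSpace G] (B : E →L[𝕜] F →L[𝕜] G)
    {x : ι → E} {y : κ → F} (hx : Summable fun i => ‖x i‖) (hy : Summable fun k => ‖y k‖) :
    HasSum (fun p : ι × κ => B (x p.1) (y p.2)) (B (∑' i, x i) (∑' k, y k)) := by
  have hs : Summable fun p : ι × κ => B (x p.1) (y p.2) := by
    refine Summable.of_norm_bounded ((hx.mul_of_nonneg hy (fun _ => norm_nonneg _)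
      (fun _ => norm_nonneg _)).mul_left ‖B‖) fun p => ?_
    simpa [mul_assoc] using B.le_opNorm₂ (x p.1) (y p.2)
  convert hs.hasSum using 1
  rw [hs.tsum_prod, ContinuousLinearMap.map_tsum B hx.of_norm,
    ← ContinuousLinearMap.apply_apply (𝕜 := 𝕜) (∑' k, y k) (∑' i, B (x i)),
    ContinuousLinearMap.map_tsum _ (show Summable fun i => B (x i) from
      hx.of_norm.map B B.continuous)]
  refine tsum_congr fun i => ?_
  simp [ContinuousLinearMap.map_tsum (B (x i)) hy.of_norm]

/-- A double series in `X0 + X1` whose terms have preimages in the intermediate space, with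
norms dominated by a product of summable families, sums to an element of that space. -/
theorem Intermediate.exists_tsum {𝕜 : Type u} [RCLike 𝕜] {X : BanachCouple.{u, v} 𝕜} {C : Type w}
    [NormedAddCommGroup C] [NormedSpace 𝕜 C] [CompleteSpace C] (j : Intermediate X C)
    {ι κ : Type*} {f : ι × κ → X.Sum} {s : X.Sum} (hf : HasSum f s) {M : ℝ}
    {p : ι → ℝ} {q : κ → ℝ} (hp : Summable p) (hq : Summable q) (hp0 : 0 ≤ p) (hq0 : 0 ≤ q)
    (h : ∀ i k, ∃ c : C, j.incl c = f (i, k) ∧ ‖c‖ ≤ M * p i * q k) :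
    ∃ c : C, j.incl c = s ∧ ‖c‖ ≤ M * (∑' i, p i) * ∑' k, q k := by
  choose c hc hcn using h
  have hpq : Summable fun x : ι × κ => p x.1 * q x.2 := hp.mul_of_nonneg hq hp0 hq0
  have hb : ∀ x : ι × κ, ‖c x.1 x.2‖ ≤ M * (p x.1 * q x.2) := fun x => by
    simpa [mul_assoc] using hcn x.1 x.2
  have hs : Summable fun x : ι × κ => c x.1 x.2 :=
    Summable.of_norm_bounded (hpq.mul_left M) hb
  refine ⟨∑' x : ι × κ, c x.1 x.2, ?_, ?_⟩
  · rw [j.incl.map_tsum hs, ← hf.tsum_eq]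
    exact tsum_congr fun x => hc x.1 x.2
  · refine (tsum_of_norm_bounded (hpq.mul_left M).hasSum hb).trans (le_of_eq ?_)
    rw [tsum_mul_left, mul_assoc, hp.tsum_mul_tsum hq hpq]

/-! ### Banach couples and their operators -/

theorem ImageSpace.exists_norm_le_two_mul {𝕜 : Type u} [RCLike 𝕜] {V : Type v}
    [NormedAddCommGroup V] [NormedSpace 𝕜 V] {W : Type w} [AddCommGroup W] [Module 𝕜 W]
    [TopologicalSpace W] [T2Space W] (π : V →L[𝕜] W) (y : ImageSpace π) :
    ∃ x : V, ImageSpace.mk π x = y ∧ ‖x‖ ≤ 2 * ‖y‖ := by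
  rcases eq_or_ne y 0 with rfl | hy
  · exact ⟨0, by simp, by simp⟩
  · obtain ⟨x, h, hn⟩ := ImageSpace.exists_lt π y (norm_pos_iff.2 hy)
    exact ⟨x, h, by linarith⟩

namespace BanachCouple

variable {𝕜 : Type u} [RCLike 𝕜] (X : BanachCouple.{u, v} 𝕜)

theorem toE_injective : Function.Injective X.toE := ImageSpace.val_injective _

theorem in0_injective : Function.Injective X.in0 := fun x y h =>
  X.inj0 (by rw [← toE_in0, h, toE_in0])

theorem in0_eq_in1_iff {x0 : X.X0} {x1 : X.X1} : X.in0 x0 = X.in1 x1 ↔ X.i0 x0 = X.i1 x1 := by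
  rw [← X.toE_injective.eq_iff, toE_in0, toE_in1]

theorem norm_in0_le (x : X.X0) : ‖X.in0 x‖ ≤ ‖x‖ := by
  simpa using X.in0.le_of_opNorm_le (LinearMap.mkContinuous_norm_le _ zero_le_one _) x

theorem norm_in1_le (x : X.X1) : ‖X.in1 x‖ ≤ ‖x‖ := by
  simpa using X.in1.le_of_opNorm_le (LinearMap.mkContinuous_norm_le _ zero_le_one _) x

theorem exists_decomp (x : X.Sum) {ε : ℝ} (hε : 0 < ε) :
    ∃ x0 x1, x = X.in0 x0 + X.in1 x1 ∧ ‖x0‖ + ‖x1‖ < ‖x‖ + ε := by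
  obtain ⟨p, rfl, hp⟩ := ImageSpace.exists_lt X.addMap x hε
  exact ⟨p.fst, p.snd, X.mk_eq p, by rwa [WithLp.prod_norm_eq_of_L1] at hp⟩

theorem exists_decomp_two_mul (x : X.Sum) :
    ∃ x0 x1, x = X.in0 x0 + X.in1 x1 ∧ ‖x0‖ + ‖x1‖ ≤ 2 * ‖x‖ := by
  obtain ⟨p, rfl, hp⟩ := ImageSpace.exists_norm_le_two_mul X.addMap x
  exact ⟨p.fst, p.snd, X.mk_eq p, by rwa [WithLp.prod_norm_eq_of_L1] at hp⟩

theorem exists_near_of_mem_core0 {x : X.X0} (hx : x ∈ X.core0) {ε : ℝ} (hε : 0 < ε) :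
    ∃ x0 x1, X.in0 x0 = X.in1 x1 ∧ ‖x - x0‖ < ε := by
  obtain ⟨y, ⟨x1, hx1⟩, hy⟩ := Metric.mem_closure_iff.1 hx ε hε
  exact ⟨y, x1, (X.in0_eq_in1_iff).2 hx1.symm, by rwa [← dist_eq_norm]⟩

end BanachCouple

section Operators

variable {𝕜 : Type u} [RCLike 𝕜] {X : BanachCouple.{u, v₁} 𝕜} {Y : BanachCouple.{u, v₂} 𝕜}
  {Z : BanachCouple.{u, v₃} 𝕜} {X' : BanachCouple.{u, v₄} 𝕜} {Y' : BanachCouple.{u, v₅} 𝕜}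
  {Z' : BanachCouple.{u, v₆} 𝕜}

/-- Composition of operators between couples. -/
noncomputable def CoupleHom.comp (Q : CoupleHom Y Z) (P : CoupleHom X Y) : CoupleHom X Z where
  map := Q.map.comp P.map
  map0 := Q.map0.comp P.map0
  map1 := Q.map1.comp P.map1
  comm0 x := by simp [P.comm0, Q.comm0]
  comm1 x := by simp [P.comm1, Q.comm1]

/-- The operator `I - P`. -/
noncomputable def CoupleHom.oneSub (P : CoupleHom X X) : CoupleHom X X where
  map := ContinuousLinearMap.id 𝕜 _ - P.map
  map0 := ContinuousLinearMap.id 𝕜 _ - P.map0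
  map1 := ContinuousLinearMap.id 𝕜 _ - P.map1
  comm0 x := by simp [P.comm0]
  comm1 x := by simp [P.comm1]

/-- The bilinear operator `(x, y) ↦ T(S x, R y)`. -/
noncomputable def BilinearHom.precomp (T : BilinearHom X Y Z) (S : CoupleHom X' X)
    (R : CoupleHom Y' Y) :
    BilinearHom X' Y' Z where
  map := T.map.bilinearComp S.map R.map
  map0 := T.map0.bilinearComp S.map0 R.map0
  map1 := T.map1.bilinearComp S.map1 R.map1
  comm0 x y := by simp [S.comm0, R.comm0, T.comm0]
  comm1 x y := by simp [S.comm1, R.comm1, T.comm1]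

/-- The bilinear operator `(x, y) ↦ Q(T(x, y))`. -/
noncomputable def BilinearHom.postcomp (Q : CoupleHom Z Z') (T : BilinearHom X Y Z) :
    BilinearHom X Y Z' where
  map := (ContinuousLinearMap.compL 𝕜 _ _ _ Q.map).comp T.map
  map0 := (ContinuousLinearMap.compL 𝕜 _ _ _ Q.map0).comp T.map0
  map1 := (ContinuousLinearMap.compL 𝕜 _ _ _ Q.map1).comp T.map1
  comm0 x y := by simp [Q.comm0, T.comm0]
  comm1 x y := by simp [Q.comm1, T.comm1]

/-- The difference of two bilinear operators. -/
noncomputable def BilinearHom.sub (T T' : BilinearHom X Y Z) : BilinearHom X Y Z where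
  map := T.map - T'.map
  map0 := T.map0 - T'.map0
  map1 := T.map1 - T'.map1
  comm0 x y := by simp [T.comm0, T'.comm0]
  comm1 x y := by simp [T.comm1, T'.comm1]

theorem CoupleHom.norm_map0_le (P : CoupleHom X Y) (h : P.opNorm ≤ 1) (x : X.X0) :
    ‖P.map0 x‖ ≤ ‖x‖ := by
  simpa using P.map0.le_of_opNorm_le ((le_max_left _ _).trans h) x

theorem CoupleHom.norm_map1_le (P : CoupleHom X Y) (h : P.opNorm ≤ 1) (x : X.X1) :
    ‖P.map1 x‖ ≤ ‖x‖ := by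
  simpa using P.map1.le_of_opNorm_le ((le_max_right _ _).trans h) x

theorem CoupleHom.map0_mem_core0 (P : CoupleHom X Y) {x : X.X0} (hx : x ∈ X.core0) :
    P.map0 x ∈ Y.core0 := by
  refine map_mem_closure P.map0.continuous hx ?_
  rintro x ⟨x1, hx1⟩
  refine ⟨P.map1 x1, ((Y.in0_eq_in1_iff).1 ?_).symm⟩
  rw [← P.comm0, ← P.comm1, (X.in0_eq_in1_iff).2 hx1.symm]

theorem BilinearHom.map0_mem_core0 (T : BilinearHom X Y Z) {x : X.X0} (hx : x ∈ X.core0)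
    {y : Y.X0} (hy : y ∈ Y.core0) : T.map0 x y ∈ Z.core0 := by
  refine map_mem_closure₂ (f := fun x y => T.map0 x y) (by fun_prop) hx hy ?_
  rintro x ⟨x1, hx1⟩ y ⟨y1, hy1⟩
  refine ⟨T.map1 x1 y1, ((Z.in0_eq_in1_iff).1 ?_).symm⟩
  rw [← T.comm0, ← T.comm1, (X.in0_eq_in1_iff).2 hx1.symm, (Y.in0_eq_in1_iff).2 hy1.symm]

theorem exists_toE_eq_toE_reg (X : BanachCouple.{u, v} 𝕜) (x : X.reg.Sum) {ε : ℝ} (hε : 0 < ε) :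
    ∃ y : X.Sum, X.toE y = X.reg.toE x ∧ ‖y‖ ≤ ‖x‖ + ε := by
  obtain ⟨x0, x1, rfl, hp⟩ := X.reg.exists_decomp x hε
  refine ⟨X.in0 (X.core0.subtypeL x0) + X.in1 (X.core1.subtypeL x1), ?_, ?_⟩
  · rw [map_add, map_add, BanachCouple.toE_in0, BanachCouple.toE_in1, BanachCouple.toE_in0,
      BanachCouple.toE_in1]
    rfl
  · exact ((norm_add_le _ _).trans (add_le_add (X.norm_in0_le _) (X.norm_in1_le _))).trans hp.le

/-- The inclusion `X0° + X1° ⊆ X0 + X1`. -/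
noncomputable def regSumIncl (X : BanachCouple.{u, v} 𝕜) : X.reg.Sum →L[𝕜] X.Sum :=
  LinearMap.mkContinuous
    (LinearMap.codRestrict (LinearMap.range (X.addMap : WithLp 1 (X.X0 × X.X1) →ₗ[𝕜] X.E))
      (show X.reg.Sum →ₗ[𝕜] X.E from X.reg.toE) (fun x => by
        obtain ⟨y, hy, -⟩ := exists_toE_eq_toE_reg X x one_pos
        change X.reg.toE x ∈ _
        rw [← hy]
        exact y.2) : X.reg.Sum →ₗ[𝕜] X.Sum) 1
    (fun x => by
      refine le_of_forall_pos_le_add fun ε hε => ?_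
      obtain ⟨y, hy, hn⟩ := exists_toE_eq_toE_reg X x hε
      rw [one_mul]
      refine le_trans (le_of_eq (congrArg norm (X.toE_injective ?_))) hn
      exact hy.symm)

theorem toE_regSumIncl (X : BanachCouple.{u, v} 𝕜) (x : X.reg.Sum) :
    X.toE (regSumIncl X x) = X.reg.toE x := rfl

/-- The inclusion of `X⃗°` in `X⃗`, as an operator between couples. -/
noncomputable def regIncl (X : BanachCouple.{u, v} 𝕜) : CoupleHom X.reg X where
  map := regSumIncl X
  map0 := X.core0.subtypeL
  map1 := X.core1.subtypeL
  comm0 x := by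
    apply X.toE_injective
    rw [toE_regSumIncl, BanachCouple.toE_in0, BanachCouple.toE_in0]
    rfl
  comm1 x := by
    apply X.toE_injective
    rw [toE_regSumIncl, BanachCouple.toE_in1, BanachCouple.toE_in1]
    rfl

end Operators

/-! ### Consequences of the approximation property -/

section Approximation

variable {𝕜 : Type u} [RCLike 𝕜] {X : BanachCouple.{u, v₁} 𝕜} {Y : BanachCouple.{u, v₂} 𝕜}
  {Z : BanachCouple.{u, v₃} 𝕜}

/-- The operators `N = P_n^+`: they are small from `X0` to `X0 + X1`, while
`I - N = P_n + P_n^-` maps the whole of `X0 + X1` boundedly into `X0`. -/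
theorem ApproxProperty.exists_plus (h : ApproxProperty X) :
    ∃ κ : ℝ, 0 ≤ κ ∧ ∀ δ > 0, ∃ N : CoupleHom X X,
      (∀ x, ‖N.map0 x‖ ≤ κ * ‖x‖) ∧ (∀ x, ‖N.map1 x‖ ≤ κ * ‖x‖) ∧
      (∀ x, ‖X.in0 (N.map0 x)‖ ≤ δ * ‖x‖) ∧
      ∃ m : ℝ, 0 ≤ m ∧ ∀ x, ∃ v : X.X0, X.in0 v = N.oneSub.map x ∧ ‖v‖ ≤ m * ‖x‖ := by
  obtain ⟨P, Pp, Pm, Pint, Pp01, Pm10, hP, ⟨κ, hκ⟩, hid, hp, hm, hp0, -⟩ := h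
  refine ⟨κ, ((norm_nonneg _).trans (le_max_left _ _)).trans (hκ 0).1, fun δ hδ => ?_⟩
  obtain ⟨n, hn⟩ := (hp0.eventually (gt_mem_nhds hδ)).exists
  refine ⟨Pp n, fun x => (Pp n).map0.le_of_opNorm_le ((le_max_left _ _).trans (hκ n).2.1) x,
    fun x => (Pp n).map1.le_of_opNorm_le ((le_max_right _ _).trans (hκ n).2.1) x, fun x => ?_,
    ‖Pint n‖ + (‖(Pm n).map0‖ + ‖Pm10 n‖) * 2, by positivity, fun x => ?_⟩
  · rw [← (Pp n).comm0, hp]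
    exact (X.norm_in1_le _).trans ((Pp01 n).le_of_opNorm_le hn.le x)
  · obtain ⟨x0, x1, hx, hxn⟩ := X.exists_decomp_two_mul x
    refine ⟨(Pint n x).1.1 + ((Pm n).map0 x0 + Pm10 n x1), ?_, ?_⟩
    · have h1 : X.in0 (Pint n x).1.1 = (P n).map x := (hP n x).symm
      have h2 : (Pm n).map x = X.in0 ((Pm n).map0 x0) + X.in0 (Pm10 n x1) := by
        rw [hx, map_add, (Pm n).comm0, hm]
      have h3 : (Pp n).oneSub.map x = x - (Pp n).map x := rfl
      rw [map_add, map_add, h1, ← h2, h3]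
      nth_rewrite 3 [hid n x]
      abel
    · have h1 : ‖(Pint n x).1.1‖ ≤ ‖Pint n‖ * ‖x‖ :=
        (norm_fst_le (Pint n x).1).trans ((Pint n).le_opNorm x)
      have h2 : ‖(Pm n).map0 x0‖ ≤ ‖(Pm n).map0‖ * (2 * ‖x‖) :=
        ((Pm n).map0.le_opNorm x0).trans (by gcongr; linarith [norm_nonneg x1])
      have h3 : ‖Pm10 n x1‖ ≤ ‖Pm10 n‖ * (2 * ‖x‖) :=
        ((Pm10 n).le_opNorm x1).trans (by gcongr; linarith [norm_nonneg x0])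
      calc _ ≤ ‖(Pint n x).1.1‖ + (‖(Pm n).map0 x0‖ + ‖Pm10 n x1‖) :=
            (norm_add_le _ _).trans (by gcongr; exact norm_add_le _ _)
        _ ≤ _ := by linarith

/-- The operators `P_n^-`: they are small from `X1` to `X0`, while `I - P_n^- = P_n + P_n^+` maps
`X0` boundedly into `X0 ∩ X1`. -/
theorem ApproxProperty.exists_minus (h : ApproxProperty X) :
    ∃ (κ : ℝ) (P : ℕ → CoupleHom X X) (ρ : ℕ → ℝ), 0 ≤ κ ∧
      (∀ n x, ‖(P n).map0 x‖ ≤ κ * ‖x‖) ∧ (∀ n x, ‖(P n).map1 x‖ ≤ κ * ‖x‖) ∧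
      Tendsto ρ atTop (𝓝 0) ∧
      (∀ n x0 x1, X.in0 x0 = X.in1 x1 → ‖(P n).map0 x0‖ ≤ ρ n * ‖x1‖) ∧
      ∀ n, ∃ g : X.X0 →L[𝕜] X.Inter, ∀ x, X.interToSum (g x) = (P n).oneSub.map (X.in0 x) := by
  obtain ⟨P, Pp, Pm, Pint, Pp01, Pm10, hP, ⟨κ, hκ⟩, hid, hp, hm, -, hm0⟩ := h
  refine ⟨κ, Pm, fun n => ‖Pm10 n‖, ((norm_nonneg _).trans (le_max_left _ _)).trans (hκ 0).1,
    fun n x => (Pm n).map0.le_of_opNorm_le ((le_max_left _ _).trans (hκ n).2.2) x,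
    fun n x => (Pm n).map1.le_of_opNorm_le ((le_max_right _ _).trans (hκ n).2.2) x, hm0,
    fun n x0 x1 hx => ?_, fun n => ?_⟩
  · have : (Pm n).map0 x0 = Pm10 n x1 := X.in0_injective (by rw [← (Pm n).comm0, hx, hm])
    rw [this]
    exact (Pm10 n).le_opNorm x1
  · refine ⟨(Pint n).comp X.in0 + (((Pp n).map0.prod (Pp01 n)).codRestrict X.interSubmodule
      fun x => (X.in0_eq_in1_iff).1 ?_), fun x => ?_⟩
    · change X.in0 ((Pp n).map0 x) = X.in1 (Pp01 n x)
      rw [← (Pp n).comm0, hp]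
    · have h1 : (Pm n).oneSub.map (X.in0 x) = X.in0 x - (Pm n).map (X.in0 x) := rfl
      rw [add_apply, map_add, ContinuousLinearMap.comp_apply, ← hP, h1]
      change _ + X.in0 ((Pp n).map0 x) = _
      rw [← (Pp n).comm0]
      nth_rewrite 3 [hid n (X.in0 x)]
      abel

/-- If `P n` is uniformly bounded on `Z0` and tends to zero from `Z1` to `Z0`, then it tends to zero
in `Z0` uniformly on the images of a totally bounded subset of the closure of `X0 ∩ X1` under all
contractions of the couples. -/
theorem eventually_norm_map0_le {κ : ℝ} (hκ : 0 ≤ κ) {P : ℕ → CoupleHom Z Z} {ρ : ℕ → ℝ}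
    (hP : ∀ n x, ‖(P n).map0 x‖ ≤ κ * ‖x‖) (hρ : Tendsto ρ atTop (𝓝 0))
    (hPρ : ∀ n x0 x1, Z.in0 x0 = Z.in1 x1 → ‖(P n).map0 x0‖ ≤ ρ n * ‖x1‖)
    {K : Set X.X0} (hK : TotallyBounded K) (hKc : K ⊆ X.core0) {η : ℝ} (hη : 0 < η) :
    ∀ᶠ n in atTop, ∀ Q : CoupleHom X Z, Q.opNorm ≤ 1 → ∀ x ∈ K, ‖(P n).map0 (Q.map0 x)‖ ≤ η := by
  have hε : 0 < η / (2 * (κ + 1)) := by positivity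
  have hκε : κ * (η / (2 * (κ + 1))) ≤ η / 2 := by
    rw [mul_div_assoc', div_le_div_iff₀ (by positivity) (by positivity)]
    nlinarith
  -- near a point of `X0°` there is a point of `X0 ∩ X1`, where `hPρ` applies
  have pt : ∀ x ∈ X.core0, ∀ᶠ n in atTop, ∀ Q : CoupleHom X Z, Q.opNorm ≤ 1 → ∀ y : X.X0,
      ‖y - x‖ ≤ η / (2 * (κ + 1)) / 2 → ‖(P n).map0 (Q.map0 y)‖ ≤ η := by
    intro x hx
    obtain ⟨x0, x1, h01, hd⟩ := X.exists_near_of_mem_core0 hx (half_pos hε)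
    have hlim : Tendsto (fun n => |ρ n| * ‖x1‖) atTop (𝓝 0) := by
      simpa using hρ.abs.mul_const ‖x1‖
    filter_upwards [hlim.eventually (gt_mem_nhds (half_pos hη))] with n hn Q hQ y hy
    have h1 : ‖(P n).map0 (Q.map0 (y - x0))‖ ≤ η / 2 := by
      refine (hP n _).trans (le_trans ?_ hκε)
      gcongr
      refine (Q.norm_map0_le hQ _).trans ?_
      have : y - x0 = (y - x) + (x - x0) := by abel
      rw [this]
      exact (norm_add_le _ _).trans (by linarith)
    have h2 : ‖(P n).map0 (Q.map0 x0)‖ ≤ η / 2 := by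
      refine (hPρ n _ (Q.map1 x1) (by rw [← Q.comm0, h01, Q.comm1])).trans ?_
      refine le_trans ?_ hn.le
      gcongr
      · exact le_abs_self _
      · exact Q.norm_map1_le hQ x1
    have : (P n).map0 (Q.map0 y) = (P n).map0 (Q.map0 (y - x0)) + (P n).map0 (Q.map0 x0) := by
      rw [← map_add, ← map_add, sub_add_cancel]
    rw [this]
    exact (norm_add_le _ _).trans (by linarith)
  obtain ⟨t, htK, ht, hKt⟩ := Metric.finite_approx_of_totallyBounded hK _ (half_pos hε)
  filter_upwards [(Set.Finite.eventually_all ht).2 fun x hx => pt x (hKc (htK hx))]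
    with n hn Q hQ y hy
  obtain ⟨x, hx, hyx⟩ := Set.mem_iUnion₂.1 (hKt hy)
  rw [Metric.mem_ball, dist_eq_norm] at hyx
  exact hn x hx Q hQ y hyx.le

/-- The image under a compact bilinear map of a product of balls is totally bounded. -/
theorem IsCompactBilinear.totallyBounded_image {V W F : Type*}
    [NormedAddCommGroup V] [NormedSpace 𝕜 V] [NormedAddCommGroup W] [NormedSpace 𝕜 W]
    [NormedAddCommGroup F] [NormedSpace 𝕜 F] {S : V →L[𝕜] W →L[𝕜] F} (hS : IsCompactBilinear S)
    (c d : ℝ) :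
    TotallyBounded {z | ∃ x y, ‖x‖ ≤ c ∧ ‖y‖ ≤ d ∧ S x y = z} := by
  refine (hS (Metric.closedBall 0 c ×ˢ Metric.closedBall 0 d)
    (Metric.isBounded_closedBall.prod Metric.isBounded_closedBall)).subset ?_
  rintro z ⟨x, y, hx, hy, rfl⟩
  exact ⟨(x, y), ⟨by simpa using hx, by simpa using hy⟩, rfl⟩

/-- If `T : X0 × Y0 → Z0` is compact, `T(x, y)` is small in `Z0` as soon as one of the arguments,
bounded in `X0` or `Y0`, is small in the sum space. -/
theorem BilinearHom.exists_norm_map0_le (T : BilinearHom X Y Z) (hT : IsCompactBilinear T.map0)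
    {c : ℝ} (hc : 0 < c) {η : ℝ} (hη : 0 < η) :
    ∃ δ > 0, ∀ x y, ‖x‖ ≤ c → ‖y‖ ≤ c → (‖X.in0 x‖ ≤ δ ∨ ‖Y.in0 y‖ ≤ δ) → ‖T.map0 x y‖ ≤ η := by
  obtain ⟨δ, hδ, h⟩ := exists_norm_le_of_totallyBounded Z.in0 Z.in0_injective
    (hT.totallyBounded_image c c) hη
  refine ⟨δ / ((‖T.map‖ + 1) * c), by positivity, fun x y hx hy hxy =>
    h _ ⟨x, y, hx, hy, rfl⟩ ?_⟩
  rw [← T.comm0]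
  have h1 : ‖X.in0 x‖ * ‖Y.in0 y‖ ≤ δ / ((‖T.map‖ + 1) * c) * c := by
    rcases hxy with hxy | hxy
    · exact mul_le_mul hxy ((Y.norm_in0_le y).trans hy) (norm_nonneg _) (by positivity)
    · rw [mul_comm]
      exact mul_le_mul hxy ((X.norm_in0_le x).trans hx) (norm_nonneg _) (by positivity)
  calc ‖T.map (X.in0 x) (Y.in0 y)‖ ≤ ‖T.map‖ * (‖X.in0 x‖ * ‖Y.in0 y‖) := by
        simpa [mul_assoc] using T.map.le_opNorm₂ (X.in0 x) (Y.in0 y)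
    _ ≤ (‖T.map‖ + 1) * (δ / ((‖T.map‖ + 1) * c) * c) := by
        gcongr
        linarith
    _ = δ := by field_simp

theorem IsPhiZero.exists_pos_le {φ : ℝ≥0 → ℝ≥0 → ℝ≥0} (hφ : IsPhiZero φ) (M : ℝ≥0) {η : ℝ}
    (hη : 0 < η) : ∃ δ : ℝ≥0, 0 < δ ∧ (φ δ M : ℝ) ≤ η := by
  lift η to ℝ≥0 using hη.le
  have hη' : 0 < η / (M + 1) := div_pos (by exact_mod_cast hη) (by positivity)
  obtain ⟨s, hs, hs0⟩ := ((hφ.lim_left.eventually (gt_mem_nhds hη')).and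
    self_mem_nhdsWithin).exists
  refine ⟨(M + 1) * s, mul_pos (by positivity) hs0, ?_⟩
  norm_cast
  calc φ ((M + 1) * s) M ≤ φ ((M + 1) * s) ((M + 1) * 1) :=
        hφ.mono _ _ _ _ le_rfl (by simp)
    _ = (M + 1) * φ s 1 := hφ.homog _ _ _ (by positivity)
    _ ≤ (M + 1) * (η / (M + 1)) := by gcongr
    _ = η := by field_simp

end Approximation

/-! ### Interpolation and the approximation of `T` -/

section Interpolation

variable {𝕜 : Type u} [RCLike 𝕜]
  {Ac : BanachCouple.{u, v₁} 𝕜} {Bc : BanachCouple.{u, v₂} 𝕜} {Cc : BanachCouple.{u, v₃} 𝕜}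
  {A : Type w₁} [NormedAddCommGroup A] [NormedSpace 𝕜 A]
  {B : Type w₂} [NormedAddCommGroup B] [NormedSpace 𝕜 B]
  {C : Type w₃} [NormedAddCommGroup C] [NormedSpace 𝕜 C]
  {jA : Intermediate Ac A} {jB : Intermediate Bc B} {jC : Intermediate Cc C}
  {φ : ℝ≥0 → ℝ≥0 → ℝ≥0}
  {X : BanachCouple.{u, v₄} 𝕜} {Y : BanachCouple.{u, v₅} 𝕜} {Z : BanachCouple.{u, v₆} 𝕜}

/-- `(A, B; C) ∈ 𝓑_φ(A⃗°, B⃗°; C⃗)` bounds an operator on `A⃗ × B⃗` by its norm on `A1 × B1` and the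
norm of its restriction to `A0° × B0°`. -/
theorem IsBilinearInterpolation.exists_of_reg {jA' : Intermediate Ac.reg A}
    (hjA' : ∀ a, Ac.reg.toE (jA'.incl a) = Ac.toE (jA.incl a))
    {jB' : Intermediate Bc.reg B} (hjB' : ∀ b, Bc.reg.toE (jB'.incl b) = Bc.toE (jB.incl b))
    (hint : IsBilinearInterpolation φ jA' jB' jC) (hφ : IsPhi φ) (W : BilinearHom Ac Bc Cc)
    {δ M : ℝ≥0} (h0 : ∀ a ∈ Ac.core0, ∀ b ∈ Bc.core0, ‖W.map0 a b‖ ≤ δ * ‖a‖ * ‖b‖)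
    (h1 : ∀ a b, ‖W.map1 a b‖ ≤ M * ‖a‖ * ‖b‖) (a : A) (b : B) :
    ∃ c : C, jC.incl c = W.map (jA.incl a) (jB.incl b) ∧ ‖c‖ ≤ φ δ M * ‖a‖ * ‖b‖ := by
  obtain ⟨S, hS, hn⟩ := hint (W.precomp (regIncl Ac) (regIncl Bc))
  refine ⟨S a b, ?_, ?_⟩
  · have ha : (regIncl Ac).map (jA'.incl a) = jA.incl a := Ac.toE_injective (hjA' a)
    have hb : (regIncl Bc).map (jB'.incl b) = jB.incl b := Bc.toE_injective (hjB' b)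
    rw [hS, ← ha, ← hb]
    rfl
  · have e0 : ‖(W.precomp (regIncl Ac) (regIncl Bc)).map0‖ ≤ δ :=
      ContinuousLinearMap.opNorm_le_bound₂ _ δ.2 fun x y => h0 _ x.2 _ y.2
    have e1 : ‖(W.precomp (regIncl Ac) (regIncl Bc)).map1‖ ≤ M :=
      ContinuousLinearMap.opNorm_le_bound₂ _ M.2 fun x y => h1 _ _
    have e : ‖S‖ ≤ φ δ M := by
      have := hn.trans (hφ.mono _ _ _ _ (NNReal.coe_le_coe.1 e0) (NNReal.coe_le_coe.1 e1))
      exact_mod_cast this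
    refine (S.le_opNorm₂ a b).trans ?_
    gcongr

/-- All the operators `Q ∘ T ∘ (S, R)` with contractions `Q`, `S`, `R` are approximated in the norm
of bilinear maps `A × B → C`, uniformly, by operators `U ∘ Q ∘ T ∘ (S ∘ V, R ∘ W)`, where
`V : A → A0`, `W : B → B0` and `U : C0 → C0 ∩ C1` are bounded. -/
theorem exists_approximation
    (hAc : ApproxProperty Ac) (hBc : ApproxProperty Bc) (hCc : ApproxProperty Cc)
    {jA' : Intermediate Ac.reg A} (hjA' : ∀ a, Ac.reg.toE (jA'.incl a) = Ac.toE (jA.incl a))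
    {jB' : Intermediate Bc.reg B} (hjB' : ∀ b, Bc.reg.toE (jB'.incl b) = Bc.toE (jB.incl b))
    (hint : IsBilinearInterpolation φ jA' jB' jC) (hφ : IsPhiZero φ)
    (T : BilinearHom X Y Z) (hT : IsCompactBilinear T.map0) {η : ℝ} (hη : 0 < η) :
    ∃ (V : CoupleHom Ac Ac) (W : CoupleHom Bc Bc) (U : CoupleHom Cc Cc),
      (∃ m : ℝ, 0 ≤ m ∧ ∀ x, ∃ v : Ac.X0, Ac.in0 v = V.map x ∧ ‖v‖ ≤ m * ‖x‖) ∧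
      (∃ m : ℝ, 0 ≤ m ∧ ∀ x, ∃ v : Bc.X0, Bc.in0 v = W.map x ∧ ‖v‖ ≤ m * ‖x‖) ∧
      (∃ g : Cc.X0 →L[𝕜] Cc.Inter, ∀ x, Cc.interToSum (g x) = U.map (Cc.in0 x)) ∧
      ∀ (S : UnitBall Ac X) (R : UnitBall Bc Y) (Q : UnitBall Z Cc) (a : A) (b : B), ∃ d : C,
        jC.incl d = Q.1.map (T.map (S.1.map (jA.incl a)) (R.1.map (jB.incl b))) -
          U.map (Q.1.map (T.map (S.1.map (V.map (jA.incl a))) (R.1.map (W.map (jB.incl b))))) ∧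
        ‖d‖ ≤ η * ‖a‖ * ‖b‖ := by
  obtain ⟨κA, hκA, hA⟩ := hAc.exists_plus
  obtain ⟨κB, hκB, hB⟩ := hBc.exists_plus
  obtain ⟨κC, P, ρ, hκC, hP0, hP1, hρ, hPρ, hPg⟩ := hCc.exists_minus
  let M : ℝ≥0 := ⟨‖T.map1‖ + (1 + κC) * (‖T.map1‖ * (1 + κA) * (1 + κB)), by positivity⟩
  obtain ⟨δ, hδ, hδφ⟩ := hφ.exists_pos_le M hη
  have hδ3 : (0 : ℝ) < δ / 3 := by positivity
  set c : ℝ := 1 + κA + κB with hc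
  have hc0 : 0 < c := by positivity
  obtain ⟨ε, hε, hTε⟩ := T.exists_norm_map0_le hT hc0 hδ3
  obtain ⟨N, hN0, hN1, hNε, hNv⟩ := hA ε hε
  obtain ⟨N', hN'0, hN'1, hN'ε, hN'v⟩ := hB ε hε
  obtain ⟨n, hn⟩ := (eventually_norm_map0_le (X := Z) hκC hP0 hρ hPρ
    ((hT.totallyBounded_image c c).subset (Set.inter_subset_left (t := (Z.core0 : Set Z.X0))))
    Set.inter_subset_right hδ3).exists
  refine ⟨N.oneSub, N'.oneSub, (P n).oneSub, hNv, hN'v, hPg n, fun S R Q a b => ?_⟩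
  let D : BilinearHom Ac Bc Cc := ((T.precomp S.1 R.1).postcomp Q.1).sub
    ((T.precomp (S.1.comp N.oneSub) (R.1.comp N'.oneSub)).postcomp ((P n).oneSub.comp Q.1))
  have key : ∃ d : C, jC.incl d = D.map (jA.incl a) (jB.incl b) ∧
      ‖d‖ ≤ φ δ M * ‖a‖ * ‖b‖ := by
    refine hint.exists_of_reg hjA' hjB' hφ.toIsPhi D
      (bilinear_bound_of_unit D.map0 Ac.core0 Bc.core0 fun a ha b hb han hbn => ?_)
      (fun a b => ?_) a b
    · -- the three terms are small because `N a` and `N' b` are small in the sum spaces, and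
      -- because `P n` is small on the compact image of `A0° × B0°`
      have hSv : ‖S.1.map0 (N.oneSub.map0 a)‖ ≤ c := by
        refine (S.1.norm_map0_le S.2 _).trans ((norm_sub_le a (N.map0 a)).trans ?_)
        have := (hN0 a).trans (mul_le_of_le_one_right hκA han)
        linarith
      have hRw : ‖R.1.map0 (N'.oneSub.map0 b)‖ ≤ c := by
        refine (R.1.norm_map0_le R.2 _).trans ((norm_sub_le b (N'.map0 b)).trans ?_)
        have := (hN'0 b).trans (mul_le_of_le_one_right hκB hbn)
        linarith
      have hSN : ‖S.1.map0 (N.map0 a)‖ ≤ c := by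
        refine (S.1.norm_map0_le S.2 _).trans ?_
        have := (hN0 a).trans (mul_le_of_le_one_right hκA han)
        linarith
      have hRN : ‖R.1.map0 (N'.map0 b)‖ ≤ c := by
        refine (R.1.norm_map0_le R.2 _).trans ?_
        have := (hN'0 b).trans (mul_le_of_le_one_right hκB hbn)
        linarith
      have hRb : ‖R.1.map0 b‖ ≤ c := by
        refine (R.1.norm_map0_le R.2 _).trans ?_
        linarith
      have t1 : ‖Q.1.map0 (T.map0 (S.1.map0 (N.map0 a)) (R.1.map0 b))‖ ≤ δ / 3 := by
        refine (Q.1.norm_map0_le Q.2 _).trans (hTε _ _ hSN hRb (Or.inl ?_))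
        rw [← S.1.comm0]
        exact (S.1.norm_map_le S.2 _).trans ((hNε a).trans (mul_le_of_le_one_right hε.le han))
      have t2 : ‖Q.1.map0 (T.map0 (S.1.map0 (N.oneSub.map0 a)) (R.1.map0 (N'.map0 b)))‖
          ≤ δ / 3 := by
        refine (Q.1.norm_map0_le Q.2 _).trans (hTε _ _ hSv hRN (Or.inr ?_))
        rw [← R.1.comm0]
        exact (R.1.norm_map_le R.2 _).trans ((hN'ε b).trans (mul_le_of_le_one_right hε.le hbn))
      have t3 : ‖(P n).map0 (Q.1.map0 (T.map0 (S.1.map0 (N.oneSub.map0 a))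
          (R.1.map0 (N'.oneSub.map0 b))))‖ ≤ δ / 3 :=
        hn Q.1 Q.2 _ ⟨⟨_, _, hSv, hRw, rfl⟩, T.map0_mem_core0
          (S.1.map0_mem_core0 (N.oneSub.map0_mem_core0 ha))
          (R.1.map0_mem_core0 (N'.oneSub.map0_mem_core0 hb))⟩
      have e : D.map0 a b = Q.1.map0 (T.map0 (S.1.map0 (N.map0 a)) (R.1.map0 b)) +
          Q.1.map0 (T.map0 (S.1.map0 (N.oneSub.map0 a)) (R.1.map0 (N'.map0 b))) +
          (P n).map0 (Q.1.map0 (T.map0 (S.1.map0 (N.oneSub.map0 a))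
            (R.1.map0 (N'.oneSub.map0 b)))) := by
        change Q.1.map0 (T.map0 (S.1.map0 a) (R.1.map0 b)) -
          (Q.1.map0 (T.map0 (S.1.map0 (a - N.map0 a)) (R.1.map0 (b - N'.map0 b))) -
            (P n).map0 (Q.1.map0 (T.map0 (S.1.map0 (a - N.map0 a))
              (R.1.map0 (b - N'.map0 b))))) =
          Q.1.map0 (T.map0 (S.1.map0 (N.map0 a)) (R.1.map0 b)) +
          Q.1.map0 (T.map0 (S.1.map0 (a - N.map0 a)) (R.1.map0 (N'.map0 b))) +
          (P n).map0 (Q.1.map0 (T.map0 (S.1.map0 (a - N.map0 a)) (R.1.map0 (b - N'.map0 b))))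
        simp only [map_sub, sub_apply]
        abel
      rw [e]
      refine (norm_add₃_le).trans ?_
      linarith
    · have hSv : ‖S.1.map1 (N.oneSub.map1 a)‖ ≤ (1 + κA) * ‖a‖ := by
        refine (S.1.norm_map1_le S.2 _).trans ((norm_sub_le a (N.map1 a)).trans ?_)
        linarith [hN1 a]
      have hRw : ‖R.1.map1 (N'.oneSub.map1 b)‖ ≤ (1 + κB) * ‖b‖ := by
        refine (R.1.norm_map1_le R.2 _).trans ((norm_sub_le b (N'.map1 b)).trans ?_)
        linarith [hN'1 b]
      have t1 : ‖Q.1.map1 (T.map1 (S.1.map1 a) (R.1.map1 b))‖ ≤ ‖T.map1‖ * ‖a‖ * ‖b‖ := by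
        refine (Q.1.norm_map1_le Q.2 _).trans ((T.map1.le_opNorm₂ _ _).trans ?_)
        gcongr
        · exact S.1.norm_map1_le S.2 a
        · exact R.1.norm_map1_le R.2 b
      have t2 : ‖Q.1.map1 (T.map1 (S.1.map1 (N.oneSub.map1 a)) (R.1.map1 (N'.oneSub.map1 b)))‖
          ≤ ‖T.map1‖ * ((1 + κA) * ‖a‖) * ((1 + κB) * ‖b‖) := by
        refine (Q.1.norm_map1_le Q.2 _).trans ((T.map1.le_opNorm₂ _ _).trans ?_)
        gcongr
      have t3 : ∀ z, ‖(P n).oneSub.map1 z‖ ≤ (1 + κC) * ‖z‖ := fun z => by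
        refine (norm_sub_le z ((P n).map1 z)).trans ?_
        linarith [hP1 n z]
      calc ‖D.map1 a b‖ ≤ ‖Q.1.map1 (T.map1 (S.1.map1 a) (R.1.map1 b))‖ +
            ‖(P n).oneSub.map1 (Q.1.map1 (T.map1 (S.1.map1 (N.oneSub.map1 a))
              (R.1.map1 (N'.oneSub.map1 b))))‖ := norm_sub_le _ _
        _ ≤ ‖T.map1‖ * ‖a‖ * ‖b‖ +
            (1 + κC) * (‖T.map1‖ * ((1 + κA) * ‖a‖) * ((1 + κB) * ‖b‖)) :=
            add_le_add t1 ((t3 _).trans (by gcongr))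
        _ = M * ‖a‖ * ‖b‖ := by
            change _ = (‖T.map1‖ + (1 + κC) * (‖T.map1‖ * (1 + κA) * (1 + κB))) * ‖a‖ * ‖b‖
            ring
  obtain ⟨d, hd, hdn⟩ := key
  exact ⟨d, hd, hdn.trans (by gcongr)⟩

end Interpolation

/-! ### Orbits and coorbits -/

section OrbitCoorbit

variable {𝕜 : Type u} [RCLike 𝕜]

/-- Elements of the orbit space are sums of orbit series; the factor `2` avoids an `ε`. -/
theorem Orb.exists_rep {A : Type w} [NormedAddCommGroup A] [NormedSpace 𝕜 A]
    {Ac : BanachCouple.{u, v₁} 𝕜} (j : Intermediate Ac A) (X : BanachCouple.{u, v₂} 𝕜)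
    (x : Orb j X) : ∃ a : UnitBall Ac X → A, (Summable fun S => ‖a S‖) ∧
      ∑' S, ‖a S‖ ≤ 2 * ‖x‖ ∧ Orb.toSum j X x = ∑' S : UnitBall Ac X, S.1.map (j.incl (a S)) := by
  obtain ⟨a, rfl, ha⟩ := ImageSpace.exists_norm_le_two_mul (orbMap j X) x
  refine ⟨a, lp_one_summable_norm a, ?_, rfl⟩
  rw [lp.norm_eq_tsum_rpow (by simp)] at ha
  simpa using ha

theorem Corb.exists_of_forall {C : Type w} [NormedAddCommGroup C] [NormedSpace 𝕜 C]
    {Cc : BanachCouple.{u, v₁} 𝕜} (j : Intermediate Cc C) (Z : BanachCouple.{u, v₂} 𝕜)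
    {z : Z.Sum} {M : ℝ} (h : ∀ Q : UnitBall Z Cc, ∃ c : C, j.incl c = Q.1.map z ∧ ‖c‖ ≤ M) :
    z ∈ corbSubmodule j Z := by
  choose c hc hcn using h
  exact ⟨⟨c, memℓp_infty ⟨M, by rintro _ ⟨Q, rfl⟩; exact hcn Q⟩⟩, hc⟩

theorem Corb.norm_le {C : Type w} [NormedAddCommGroup C] [NormedSpace 𝕜 C]
    {Cc : BanachCouple.{u, v₁} 𝕜} (j : Intermediate Cc C) (Z : BanachCouple.{u, v₂} 𝕜)
    (z : Corb j Z) {M : ℝ} (hM : 0 ≤ M) (h : ∀ Q, ‖Corb.family j Z z Q‖ ≤ M) : ‖z‖ ≤ M :=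
  lp.norm_le_of_forall_le hM h

theorem Corb.dist_le {C : Type w} [NormedAddCommGroup C] [NormedSpace 𝕜 C]
    {Cc : BanachCouple.{u, v₁} 𝕜} (j : Intermediate Cc C) (Z : BanachCouple.{u, v₂} 𝕜)
    (z z' : Corb j Z) {M : ℝ} (hM : 0 ≤ M)
    (h : ∀ Q, ‖Corb.family j Z z Q - Corb.family j Z z' Q‖ ≤ M) : dist z z' ≤ M := by
  rw [dist_eq_norm]
  refine Corb.norm_le j Z _ hM fun Q => ?_
  have : Corb.family j Z (z - z') = Corb.family j Z z - Corb.family j Z z' :=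
    map_sub (Corb.familyMap j Z) z z'
  rw [this]
  exact h Q

theorem summable_norm_map {A : Type w} [NormedAddCommGroup A] [NormedSpace 𝕜 A]
    {Ac : BanachCouple.{u, v₁} 𝕜} {X : BanachCouple.{u, v₂} 𝕜} (i : A →L[𝕜] Ac.Sum)
    {a : UnitBall Ac X → A} (ha : Summable fun S => ‖a S‖) :
    Summable fun S : UnitBall Ac X => ‖S.1.map (i (a S))‖ :=
  Summable.of_nonneg_of_le (fun _ => norm_nonneg _) (fun S =>
    (S.1.norm_map_le S.2 _).trans (i.le_opNorm _)) (ha.mul_left ‖i‖)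

/-- If `V` maps the sum space into `A0`, the sum of an orbit series after `V` is an element of `X0`
controlled by the `ℓ₁` norm of the coefficients. -/
theorem Intermediate.exists_in0_eq_tsum {A : Type w} [NormedAddCommGroup A] [NormedSpace 𝕜 A]
    {Ac : BanachCouple.{u, v₁} 𝕜} (j : Intermediate Ac A) {X : BanachCouple.{u, v₂} 𝕜}
    (V : CoupleHom Ac Ac) {m : ℝ} (hm : 0 ≤ m)
    (hV : ∀ x, ∃ v : Ac.X0, Ac.in0 v = V.map x ∧ ‖v‖ ≤ m * ‖x‖)
    {a : UnitBall Ac X → A} (ha : Summable fun S => ‖a S‖) :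
    ∃ x0 : X.X0, X.in0 x0 = ∑' S : UnitBall Ac X, S.1.map (V.map (j.incl (a S))) ∧
      ‖x0‖ ≤ m * ‖j.incl‖ * ∑' S, ‖a S‖ := by
  choose v hv hvn using hV
  have hb : ∀ S : UnitBall Ac X, ‖S.1.map0 (v (j.incl (a S)))‖ ≤ m * ‖j.incl‖ * ‖a S‖ :=
    fun S => by
      refine (S.1.norm_map0_le S.2 _).trans ((hvn _).trans ?_)
      rw [mul_assoc]
      gcongr
      exact j.incl.le_opNorm _
  have hs := ha.mul_left (m * ‖j.incl‖)
  refine ⟨∑' S : UnitBall Ac X, S.1.map0 (v (j.incl (a S))), ?_, ?_⟩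
  · rw [X.in0.map_tsum (Summable.of_norm_bounded hs hb)]
    exact tsum_congr fun S => by rw [← S.1.comm0, hv]
  · rw [← tsum_mul_left]
    exact tsum_of_norm_bounded hs.hasSum hb

end OrbitCoorbit

end Interp

theorem theorem4p6 {𝕜 : Type u} [RCLike 𝕜]
    -- the couples `A⃗`, `B⃗`, `C⃗`
    (Ac : BanachCouple.{u, v₁} 𝕜) (Bc : BanachCouple.{u, v₂} 𝕜) (Cc : BanachCouple.{u, v₃} 𝕜)
    -- the intermediate Banach spaces `A`, `B`, `C`
    (A : Type w₁) [NormedAddCommGroup A] [NormedSpace 𝕜 A] [CompleteSpace A]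
    (B : Type w₂) [NormedAddCommGroup B] [NormedSpace 𝕜 B] [CompleteSpace B]
    (C : Type w₃) [NormedAddCommGroup C] [NormedSpace 𝕜 C] [CompleteSpace C]
    (jA : Intermediate Ac A) (jB : Intermediate Bc B) (jC : Intermediate Cc C)
    (hAc : ApproxProperty Ac) (hBc : ApproxProperty Bc) (hCc : ApproxProperty Cc)
    (hψA : Tendsto (fun s => jA.psi s 1) (𝓝[>] 0) (𝓝 0))
    (hψB : Tendsto (fun s => jB.psi s 1) (𝓝[>] 0) (𝓝 0))
    (hφC : Tendsto (fun s => jC.phi s 1) (𝓝[>] 0) (𝓝 0))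
    (φ : ℝ≥0 → ℝ≥0 → ℝ≥0) (hφ : IsPhiZero φ)
    -- `(A, B; C) ∈ 𝓑_φ(A⃗, B⃗; C⃗)`
    (hint : IsBilinearInterpolation φ jA jB jC)
    -- `(A, B; C) ∈ 𝓑_φ(A⃗°, B⃗°; C⃗)`, with the same spaces `A` and `B`
    (jA' : Intermediate Ac.reg A) (hjA' : ∀ a, Ac.reg.toE (jA'.incl a) = Ac.toE (jA.incl a))
    (jB' : Intermediate Bc.reg B) (hjB' : ∀ b, Bc.reg.toE (jB'.incl b) = Bc.toE (jB.incl b))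
    (hint' : IsBilinearInterpolation φ jA' jB' jC)
    (X : BanachCouple.{u, v₄} 𝕜) (Y : BanachCouple.{u, v₅} 𝕜) (Z : BanachCouple.{u, v₆} 𝕜)
    (T : BilinearHom X Y Z) (hT : IsCompactBilinear T.map0) :
    ∃ S : Orb jA X →L[𝕜] Orb jB Y →L[𝕜] Corb jC Z,
      (∀ x y, Corb.toSum jC Z (S x y) = T.map (Orb.toSum jA X x) (Orb.toSum jB Y y)) ∧
      IsCompactBilinear S := by
  -- each `Q ∘ T ∘ (S, R)` is bounded `A × B → C`; summation gives the bound on the orbits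
  have hbd : ∃ M : ℝ, 0 ≤ M ∧ ∀ (x : Orb jA X) (y : Orb jB Y) (Q : UnitBall Z Cc), ∃ c : C,
      jC.incl c = Q.1.map (T.map (Orb.toSum jA X x) (Orb.toSum jB Y y)) ∧
      ‖c‖ ≤ M * ‖x‖ * ‖y‖ := by
    refine ⟨φ ‖T.map0‖₊ ‖T.map1‖₊ * 2 * 2, by positivity, fun x y Q => ?_⟩
    obtain ⟨a, ha, han, hx⟩ := Orb.exists_rep jA X x
    obtain ⟨b, hb, hbn, hy⟩ := Orb.exists_rep jB Y y
    obtain ⟨c, hc, hcn⟩ := jC.exists_tsum (M := φ ‖T.map0‖₊ ‖T.map1‖₊)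
      (hasSum_bilinear (T.postcomp Q.1).map (summable_norm_map jA.incl ha)
        (summable_norm_map jB.incl hb)) ha hb
      (fun _ => norm_nonneg _) (fun _ => norm_nonneg _) (fun S R => by
        obtain ⟨c, hc, hcn⟩ := hint'.exists_of_reg hjA' hjB' hφ.toIsPhi
          ((T.precomp S.1 R.1).postcomp Q.1) (δ := ‖T.map0‖₊) (M := ‖T.map1‖₊)
          (fun u _ v _ => by
            refine (Q.1.norm_map0_le Q.2 _).trans ((T.map0.le_opNorm₂ _ _).trans ?_)
            rw [coe_nnnorm]
            gcongr
            · exact S.1.norm_map0_le S.2 u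
            · exact R.1.norm_map0_le R.2 v)
          (fun u v => by
            refine (Q.1.norm_map1_le Q.2 _).trans ((T.map1.le_opNorm₂ _ _).trans ?_)
            rw [coe_nnnorm]
            gcongr
            · exact S.1.norm_map1_le S.2 u
            · exact R.1.norm_map1_le R.2 v) (a S) (b R)
        exact ⟨c, hc, hcn⟩)
    refine ⟨c, by rw [hc, hx, hy]; rfl, hcn.trans ?_⟩
    calc (φ ‖T.map0‖₊ ‖T.map1‖₊ : ℝ) * (∑' S, ‖a S‖) * ∑' R, ‖b R‖
        ≤ φ ‖T.map0‖₊ ‖T.map1‖₊ * (2 * ‖x‖) * (2 * ‖y‖) := by gcongr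
      _ = _ := by ring
  obtain ⟨M, hM, hbd⟩ := hbd
  have hmem : ∀ (x : Orb jA X) (y : Orb jB Y),
      T.map (Orb.toSum jA X x) (Orb.toSum jB Y y) ∈ corbSubmodule jC Z := fun x y =>
    Corb.exists_of_forall jC Z (hbd x y)
  let L : Orb jA X →ₗ[𝕜] Orb jB Y →ₗ[𝕜] Corb jC Z := LinearMap.mk₂ 𝕜
    (fun x y => (⟨T.map (Orb.toSum jA X x) (Orb.toSum jB Y y), hmem x y⟩ : corbSubmodule jC Z))
    (fun x x' y => Subtype.ext (by simp only [map_add, add_apply]; rfl))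
    (fun r x y => Subtype.ext (by simp only [map_smul, smul_apply]; rfl))
    (fun x y y' => Subtype.ext (by simp only [map_add]; rfl))
    (fun r x y => Subtype.ext (by simp only [map_smul]; rfl))
  have hL : ∀ x y, ‖L x y‖ ≤ M * ‖x‖ * ‖y‖ := fun x y =>
    Corb.norm_le jC Z _ (by positivity) fun Q => by
      obtain ⟨c, hc, hcn⟩ := hbd x y Q
      rwa [show Corb.family jC Z (L x y) Q = c from
        jC.inj (by rw [Corb.incl_family, hc]; rfl)]
  refine ⟨L.mkContinuous₂ M hL, fun x y => rfl, fun s hs => ?_⟩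
  obtain ⟨r, hr, hsr⟩ := hs.exists_pos_norm_le
  -- up to `ε / 4`, each value of `T` at a point of `s` is the image of a point of a fixed totally
  -- bounded subset of `Z0` under the maps `h ∘ Q`, which are bounded uniformly in `Q`
  refine totallyBounded_of_approx (β := Z.X0) fun ε hε => ?_
  have hη : 0 < ε / 4 / (2 * r * (2 * r)) := by positivity
  obtain ⟨V, W, U, ⟨m, hm, hV⟩, ⟨m', hm', hW⟩, ⟨g, hg⟩, happ⟩ :=
    exists_approximation (jA := jA) (jB := jB) (jC := jC) hAc hBc hCc hjA' hjB' hint' hφ T hT hη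
  let h : Cc.X0 →L[𝕜] C := jC.interIncl.comp g
  have hh : ∀ z, jC.incl (h z) = U.map (Cc.in0 z) := fun z => by rw [← hg, ← jC.comp_eq]; rfl
  refine ⟨_, fun e z => ∀ Q : UnitBall Z Cc, ‖Corb.family jC Z e Q - h (Q.1.map0 z)‖ ≤ ε / 4,
    ε / 4 / (‖h‖ + 1),
    hT.totallyBounded_image (m * ‖jA.incl‖ * (2 * r)) (m' * ‖jB.incl‖ * (2 * r)),
    by positivity, ?_, ?_⟩
  · rintro _ ⟨⟨x, y⟩, hp, rfl⟩
    have hxr : ‖x‖ ≤ r := (norm_fst_le (x, y)).trans (hsr _ hp)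
    have hyr : ‖y‖ ≤ r := (norm_snd_le (x, y)).trans (hsr _ hp)
    obtain ⟨a, ha, han, hx⟩ := Orb.exists_rep jA X x
    obtain ⟨b, hb, hbn, hy⟩ := Orb.exists_rep jB Y y
    have han' : ∑' S, ‖a S‖ ≤ 2 * r := han.trans (by gcongr)
    have hbn' : ∑' R, ‖b R‖ ≤ 2 * r := hbn.trans (by gcongr)
    obtain ⟨x0, hx0, hx0n⟩ := jA.exists_in0_eq_tsum V hm hV ha
    obtain ⟨y0, hy0, hy0n⟩ := jB.exists_in0_eq_tsum W hm' hW hb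
    refine ⟨T.map0 x0 y0, ⟨x0, y0, hx0n.trans (by gcongr), hy0n.trans (by gcongr), rfl⟩,
      fun Q => ?_⟩
    have hsum := (hasSum_bilinear (T.postcomp Q.1).map (summable_norm_map jA.incl ha)
        (summable_norm_map jB.incl hb)).sub
      (hasSum_bilinear (T.postcomp (U.comp Q.1)).map
        (summable_norm_map (V.map.comp jA.incl) ha) (summable_norm_map (W.map.comp jB.incl) hb))
    change HasSum _ (Q.1.map (T.map (∑' S : UnitBall Ac X, S.1.map (jA.incl (a S)))
      (∑' R : UnitBall Bc Y, R.1.map (jB.incl (b R)))) -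
      U.map (Q.1.map (T.map (∑' S : UnitBall Ac X, S.1.map (V.map (jA.incl (a S))))
        (∑' R : UnitBall Bc Y, R.1.map (W.map (jB.incl (b R))))))) at hsum
    rw [← hx, ← hy, ← hx0, ← hy0, T.comm0, Q.1.comm0] at hsum
    obtain ⟨d, hd, hdn⟩ := jC.exists_tsum hsum ha hb
      (fun _ => norm_nonneg _) (fun _ => norm_nonneg _) (fun S R => happ S R Q (a S) (b R))
    have hdeq : Corb.family jC Z (L x y) Q - h (Q.1.map0 (T.map0 x0 y0)) = d := by
      apply jC.inj
      rw [map_sub, Corb.incl_family, hh, hd]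
      rfl
    change ‖Corb.family jC Z (L x y) Q - h (Q.1.map0 (T.map0 x0 y0))‖ ≤ ε / 4
    rw [hdeq]
    calc ‖d‖ ≤ _ := hdn
      _ ≤ ε / 4 / (2 * r * (2 * r)) * (2 * r) * (2 * r) := by gcongr
      _ = ε / 4 := by field_simp
  · intro e e' z z' he he' hzz
    refine lt_of_le_of_lt (Corb.dist_le jC Z e e' (M := 3 * (ε / 4)) (by positivity)
      fun Q => ?_) (by linarith)
    have h1 : ‖h (Q.1.map0 (z - z'))‖ ≤ ε / 4 := by
      have hz : ‖Q.1.map0 (z - z')‖ ≤ ε / 4 / (‖h‖ + 1) :=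
        (Q.1.norm_map0_le Q.2 _).trans (by rw [← dist_eq_norm]; exact hzz.le)
      calc ‖h (Q.1.map0 (z - z'))‖ ≤ (‖h‖ + 1) * (ε / 4 / (‖h‖ + 1)) :=
            (h.le_opNorm _).trans (by gcongr; linarith)
        _ = ε / 4 := by field_simp
    have h2 : Corb.family jC Z e Q - Corb.family jC Z e' Q =
        (Corb.family jC Z e Q - h (Q.1.map0 z)) + h (Q.1.map0 (z - z')) -
          (Corb.family jC Z e' Q - h (Q.1.map0 z')) := by
      rw [map_sub, map_sub]
      abel
    rw [h2]
    refine (norm_sub_le _ _).trans ?_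
    have := norm_add_le (Corb.family jC Z e Q - h (Q.1.map0 z)) (h (Q.1.map0 (z - z')))
    linarith [he Q, he' Q]
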